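/- Work over $\mathbb{C}$. Let $R=\mathbb{C}\langle x,y\rangle/(x^5=yxy,\ y^2=xyx)$, graded by $\deg x=1$, $\deg y=2$. Let $p_1,p_2,p_3\in\mathbb{P}^2$ be three non-collinear points and let $\mathbb{B}_3$ be the blow-up of $\mathbb{P}^2$ at $p_1,p_2,p_3$. Its six $(-1)$-curves are the exceptional curves $E_i$ over $p_i$ and the strict transforms $L_i$ of the lines through the two points $p_j$, $j\ne i$. Fix a choice of vectors $v_i\in\mathbb{C}^3$ representing the $p_i$. Let $X,Y,Z,s,t,u$ be the coordinates on $\mathbb{C}^6$ (Cox coordinates of $\mathbb{B}_3$), let $W\subset\mathbb{C}^6$ be the union of the nine subspaces $X=t=0$, $Y=s=0$, $Z=u=0$, $X=Y=0$, $Y=Z=0$, $Z=X=0$, $s=t=0$, $u=t=0$, $s=u=0$, and let $q:\mathbb{C}^6\setminus W\to\mathbb{B}_3$ be the morphism lifting $$(X,Y,Z,s,t,u)\mapsto [\,Xsu\,v_1+Ytu\,v_2+Zst\,v_3\,]\in\mathbb{P}^2 ,$$ so that $L_1,L_2,L_3,E_2,E_1,E_3$ are the images of $X=0$, $Y=0$,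 $Z=0$, $s=0$, $t=0$, $u=0$. Let $\tilde\sigma(X,Y,Z,s,t,u)=(u,t,s,X,Z,Y)$ on $\mathbb{C}^6\setminus W$. Then there are an automorphism $\sigma$ of $\mathbb{B}_3$ of order six with $\sigma\circ q=q\circ\tilde\sigma$, which permutes the $(-1)$-curves cyclically, $$\sigma^{-1}(L_1)=E_3,\quad \sigma^{-1}(E_3)=L_2,\quad \sigma^{-1}(L_2)=E_1,\quad \sigma^{-1}(E_1)=L_3,\quad \sigma^{-1}(L_3)=E_2,\quad \sigma^{-1}(E_2)=L_1,$$ and a line bundle $\mathcal{L}\cong\mathcal{O}(L_1)$ on $\mathbb{B}_3$ such that $R$ is isomorphic, as a graded $\mathbb{C}$-algebra, to the twisted homogeneous coordinate ring $$B(\mathbb{B}_3,\mathcal{L},\sigma)=\bigoplus_{n\ge 0}H^0(\mathbb{B}_3,\mathcal{L}_n),\qquad \mathcal{L}_n=\mathcal{L}\otimes\sigma^*\mathcal{L}\otimes\cdots\otimes(\sigma^*)^{n-1}\mathcal{L},$$ whose product is $a\cdot b=a\otimes(\sigma^*)^m b$ for $a\in H^0(\mathcal{L}_m)$, $b\in H^0(\mathcal{L}_n)$.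 Moreover, for a suitable trivialization of $q^*\mathcal{L}$ (and the trivializations of $q^*\mathcal{L}_n$ that it induces through $\tilde\sigma$), the isomorphism sends $x$ to the section of $\mathcal{L}_1$ whose pull-back to $\mathbb{C}^6\setminus W$ is $X$, and $y$ to the section of $\mathcal{L}_2$ whose pull-back is $Zt$. -/

import Mathlib

open TopologicalSpace
open scoped LinearAlgebra.Projectivization

noncomputable section

namespace DelPezzo

/-! ### Varieties over `ℂ` as spaces with a sheaf of regular `ℂ`-valued functions -/

/-- A sheaf of `ℂ`-algebras of `ℂ`-valued functions, the regular functions, on a topological space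
(the closed points of a variety over `ℂ` with the Zariski topology). -/
class Variety (X : Type) [TopologicalSpace X] where
  reg (U : Opens X) : Subalgebra ℂ (U → ℂ)
  res {U V : Opens X} (h : U ≤ V) {f : V → ℂ} :
    f ∈ reg V → (fun x : U => f ⟨x, h x.2⟩) ∈ reg U
  glue {U : Opens X} {f : U → ℂ} :
    (∀ x : U, ∃ V : Opens X, ∃ h : V ≤ U, (x : X) ∈ V ∧
      (fun y : V => f ⟨y, h y.2⟩) ∈ reg V) → f ∈ reg U

/-- Morphisms are the continuous maps that pull regular functions back to regular functions. -/
def IsMorphism {X Y : Type} [TopologicalSpace X] [Variety X] [TopologicalSpace Y] [Variety Y]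
    (φ : X → Y) : Prop :=
  ∃ hφ : Continuous φ, ∀ (U : Opens Y) (f : U → ℂ), f ∈ Variety.reg U →
    (fun x : Opens.comap ⟨φ, hφ⟩ U => f ⟨φ x, x.2⟩) ∈ Variety.reg (Opens.comap ⟨φ, hφ⟩ U)

/-- The automorphism group of a variety. -/
def VAut (X : Type) [TopologicalSpace X] [Variety X] : Subgroup (Equiv.Perm X) where
  carrier := {σ | IsMorphism σ ∧ IsMorphism σ.symm}
  mul_mem' := by
    rintro σ τ ⟨⟨c1, h1⟩, ⟨c2, h2⟩⟩ ⟨⟨c3, h3⟩, ⟨c4, h4⟩⟩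
    exact ⟨⟨c1.comp c3, fun U f hf => h3 _ _ (h1 U f hf)⟩,
      ⟨c4.comp c2, fun U f hf => h2 _ _ (h4 U f hf)⟩⟩
  one_mem' := ⟨⟨continuous_id, fun _ _ hf => hf⟩, ⟨continuous_id, fun _ _ hf => hf⟩⟩
  inv_mem' := by
    rintro σ ⟨h1, h2⟩
    exact ⟨h2, h1⟩

/-! ### Quasi-projective coordinates

`𝒜 d` is the space of forms of degree `d`, viewed as functions on the set `X` (for projective
varieties after a choice of representatives of the points, which affects neither zero sets nor
quotients of forms of the same degree). -/

section Coordinates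

variable {X D : Type} [AddCommMonoid D] (𝒜 : D → Submodule ℂ (X → ℂ))

/-- The Zariski topology: the non-vanishing sets of forms are a basis of the open sets. -/
@[reducible]
def zariski : TopologicalSpace X :=
  generateFrom {O | ∃ d, ∃ G ∈ 𝒜 d, O = {x | G x ≠ 0}}

/-- The regular functions are those that are, locally, quotients of two forms of the same degree. -/
@[reducible]
def zariskiVariety [SetLike.GradedMonoid 𝒜] : @Variety X (zariski 𝒜) :=
  letI := zariski 𝒜
  { reg := fun U =>
      { carrier := {f | ∀ x : U, ∃ V : Opens X, (x : X) ∈ V ∧ ∃ d, ∃ F ∈ 𝒜 d, ∃ G ∈ 𝒜 d,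
          ∀ y : U, (y : X) ∈ V → G y ≠ 0 ∧ f y = F y / G y}
        mul_mem' := by
          intro f g hf hg x
          obtain ⟨V, hV, d, F, hF, G, hG, h⟩ := hf x
          obtain ⟨V', hV', d', F', hF', G', hG', h'⟩ := hg x
          refine ⟨V ⊓ V', ⟨hV, hV'⟩, d + d', F * F', SetLike.mul_mem_graded hF hF',
            G * G', SetLike.mul_mem_graded hG hG', fun y hy => ?_⟩
          obtain ⟨a, b⟩ := h y hy.1
          obtain ⟨a', b'⟩ := h' y hy.2
          refine ⟨mul_ne_zero a a', ?_⟩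
          simp only [Pi.mul_apply, b, b']
          field_simp
        add_mem' := by
          intro f g hf hg x
          obtain ⟨V, hV, d, F, hF, G, hG, h⟩ := hf x
          obtain ⟨V', hV', d', F', hF', G', hG', h'⟩ := hg x
          refine ⟨V ⊓ V', ⟨hV, hV'⟩, d + d', F * G' + G * F',
            add_mem (SetLike.mul_mem_graded hF hG') (SetLike.mul_mem_graded hG hF'),
            G * G', SetLike.mul_mem_graded hG hG', fun y hy => ?_⟩
          obtain ⟨a, b⟩ := h y hy.1
          obtain ⟨a', b'⟩ := h' y hy.2
          refine ⟨mul_ne_zero a a', ?_⟩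
          simp only [Pi.mul_apply, Pi.add_apply, b, b']
          field_simp
        algebraMap_mem' := by
          intro r x
          refine ⟨⊤, trivial, 0, r • 1, Submodule.smul_mem _ _ (SetLike.one_mem_graded 𝒜), 1,
            SetLike.one_mem_graded 𝒜, fun y _ => ⟨one_ne_zero, ?_⟩⟩
          simp [Pi.algebraMap_apply] }
    res := by
      intro U V h f hf x
      obtain ⟨W, hW, d, F, hF, G, hG, h'⟩ := hf ⟨x, h x.2⟩
      exact ⟨W, hW, d, F, hF, G, hG, fun y hy => h' ⟨y, h y.2⟩ hy⟩
    glue := by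
      intro U f hf x
      obtain ⟨V, hVU, hxV, hV⟩ := hf x
      obtain ⟨W, hW, d, F, hF, G, hG, h'⟩ := hV ⟨x, hxV⟩
      exact ⟨W ⊓ V, ⟨hW, hxV⟩, d, F, hF, G, hG, fun y hy => h' ⟨y, hy.2⟩ hy.1⟩ }

end Coordinates

/-! ### Line bundles and their global sections -/

/-- A line bundle, given by an open cover and transition functions `g i j` on `U i ∩ U j`. -/
structure LineBundle (X : Type) [TopologicalSpace X] [Variety X] where
  ι : Type
  U : ι → Opens X
  cover : ∀ x, ∃ i, x ∈ U i
  g : ∀ i j, (U i ⊓ U j : Opens X) → ℂ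
  g_reg : ∀ i j, g i j ∈ Variety.reg (U i ⊓ U j)
  g_self : ∀ i x, g i i x = 1
  g_mul : ∀ i j k (x : X) (hi : x ∈ U i) (hj : x ∈ U j) (hk : x ∈ U k),
    g i j ⟨x, Opens.mem_inf.2 ⟨hi, hj⟩⟩ * g j k ⟨x, Opens.mem_inf.2 ⟨hj, hk⟩⟩ = g i k ⟨x, Opens.mem_inf.2 ⟨hi, hk⟩⟩

/-- The intersection of finitely many open sets. -/
def finInter {X : Type} [TopologicalSpace X] {n : ℕ} (U : Fin n → Opens X) : Opens X :=
  ⟨⋂ k, (U k : Set X), isOpen_iInter_of_finite fun k => (U k).2⟩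

theorem mem_finInter {X : Type} [TopologicalSpace X] {n : ℕ} {U : Fin n → Opens X} {x : X} :
    x ∈ finInter U ↔ ∀ k, x ∈ U k :=
  Set.mem_iInter

variable {X : Type} [TopologicalSpace X] [Variety X]

/-- `H⁰(X, L)`: families of regular functions `s i` on `U i` with `s i = g i j * s j`. -/
def H0 (L : LineBundle X) : Submodule ℂ (∀ i, L.U i → ℂ) where
  carrier := {s | (∀ i, s i ∈ Variety.reg (L.U i)) ∧
    ∀ i j (x : X) (hi : x ∈ L.U i) (hj : x ∈ L.U j),
      s i ⟨x, hi⟩ = L.g i j ⟨x, Opens.mem_inf.2 ⟨hi, hj⟩⟩ * s j ⟨x, hj⟩}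
  add_mem' := by
    rintro s t ⟨hs, hs'⟩ ⟨ht, ht'⟩
    refine ⟨fun i => add_mem (hs i) (ht i), fun i j x hi hj => ?_⟩
    simp only [Pi.add_apply, hs' i j x hi hj, ht' i j x hi hj, mul_add]
  zero_mem' := ⟨fun i => zero_mem _, fun i j x hi hj => by simp⟩
  smul_mem' := by
    rintro c s ⟨hs, hs'⟩
    refine ⟨fun i => Subalgebra.smul_mem _ (hs i) c, fun i j x hi hj => ?_⟩
    simp only [Pi.smul_apply, smul_eq_mul, hs' i j x hi hj]
    ring

/-- `L ≅ 𝒪(C)` for a closed subset `C` that is an effective Cartier divisor: `L` has a section `s`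
such that multiplication by `s i` is a bijection from the regular functions on `V` onto those that
vanish on `C ∩ V`, for all open `V ⊆ U i`. -/
def LineBundle.IsOfDivisor (L : LineBundle X) (C : Set X) : Prop :=
  ∃ s : H0 L, ∀ (i : L.ι) (V : Opens X) (hV : V ≤ L.U i),
    (∀ x : V, (x : X) ∈ C → s.1 i ⟨x, hV x.2⟩ = 0) ∧
    ∀ f ∈ Variety.reg V, (∀ x : V, (x : X) ∈ C → f x = 0) →
      ∃! h : V → ℂ, h ∈ Variety.reg V ∧ ∀ x : V, f x = h x * s.1 i ⟨x, hV x.2⟩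

theorem VAut.continuous (σ : VAut X) : Continuous (σ : Equiv.Perm X) := σ.2.1.1

/-- The pull-back `σ^* L`. -/
def LineBundle.pullback (σ : VAut X) (L : LineBundle X) : LineBundle X where
  ι := L.ι
  U i := Opens.comap ⟨(σ : Equiv.Perm X), VAut.continuous σ⟩ (L.U i)
  cover x := L.cover ((σ : Equiv.Perm X) x)
  g i j x := L.g i j ⟨(σ : Equiv.Perm X) x, x.2⟩
  g_reg i j := σ.2.1.2 _ _ (L.g_reg i j)
  g_self i _ := L.g_self i _
  g_mul i j k _ hi hj hk := L.g_mul i j k _ hi hj hk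

/-- The tensor product of finitely many line bundles (the trivial one if there are none). -/
def LineBundle.tensor {n : ℕ} (L : Fin n → LineBundle X) : LineBundle X where
  ι := ∀ k, (L k).ι
  U I := finInter fun k => (L k).U (I k)
  cover x := ⟨fun k => ((L k).cover x).choose,
    mem_finInter.2 fun k => ((L k).cover x).choose_spec⟩
  g I J x := ∏ k, (L k).g (I k) (J k) ⟨x, Opens.mem_inf.2
    ⟨mem_finInter.1 (Opens.mem_inf.1 x.2).1 k, mem_finInter.1 (Opens.mem_inf.1 x.2).2 k⟩⟩
  g_reg I J := by
    have : ∀ k ∈ (Finset.univ : Finset (Fin n)), _ := fun k _ =>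
      Variety.res (U := finInter (fun k => (L k).U (I k)) ⊓ finInter fun k => (L k).U (J k))
        (V := (L k).U (I k) ⊓ (L k).U (J k)) (fun x hx => Opens.mem_inf.2
          ⟨mem_finInter.1 (Opens.mem_inf.1 hx).1 k, mem_finInter.1 (Opens.mem_inf.1 hx).2 k⟩)
        ((L k).g_reg (I k) (J k))
    convert prod_mem this using 1
    funext x
    simp only [Finset.prod_apply]
  g_self I x := by simp only [(L _).g_self, Finset.prod_const_one]
  g_mul I J K x hI hJ hK := by
    rw [← Finset.prod_mul_distrib]
    exact Finset.prod_congr rfl fun k _ => (L k).g_mul _ _ _ x (mem_finInter.1 hI k) (mem_finInter.1 hJ k)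
      (mem_finInter.1 hK k)

/-- `L_n = L ⊗ σ^* L ⊗ ⋯ ⊗ (σ^*)^(n-1) L`. -/
def LineBundle.twist (L : LineBundle X) (σ : VAut X) (n : ℕ) : LineBundle X :=
  LineBundle.tensor fun k : Fin n => L.pullback (σ ^ (k : ℕ))

/-! ### Twisted homogeneous coordinate rings -/

/-- The homogeneous component `B_n = H⁰(X, L_n)`. -/
abbrev TwistedPiece (L : LineBundle X) (σ : VAut X) (n : ℕ) : Type := H0 (L.twist σ n)

variable {L : LineBundle X} {σ : VAut X}

theorem act_add (σ : VAut X) (m k : ℕ) (x : X) :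
    ((σ ^ (m + k) : VAut X) : Equiv.Perm X) x =
      ((σ ^ k : VAut X) : Equiv.Perm X) (((σ ^ m : VAut X) : Equiv.Perm X) x) := by
  rw [add_comm, pow_add]
  rfl

theorem mem_twist {n : ℕ} {I : Fin n → L.ι} {x : X} :
    x ∈ (L.twist σ n).U I ↔ ∀ k, ((σ ^ (k : ℕ) : VAut X) : Equiv.Perm X) x ∈ L.U (I k) :=
  mem_finInter

theorem twist_left {m n : ℕ} {I : Fin (m + n) → L.ι} {x : X}
    (hx : x ∈ (L.twist σ (m + n)).U I) :
    x ∈ (L.twist σ m).U (fun k => I (Fin.castAdd n k)) :=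
  mem_twist.2 fun k => mem_twist.1 hx (Fin.castAdd n k)

theorem twist_right {m n : ℕ} {I : Fin (m + n) → L.ι} {x : X}
    (hx : x ∈ (L.twist σ (m + n)).U I) :
    ((σ ^ m : VAut X) : Equiv.Perm X) x ∈ (L.twist σ n).U (fun k => I (Fin.natAdd m k)) := by
  refine mem_twist.2 fun k => ?_
  rw [← act_add]
  exact mem_twist.1 hx (Fin.natAdd m k)

theorem twist_g {n : ℕ} (I J : Fin n → L.ι) (x : X) (hI : x ∈ (L.twist σ n).U I)
    (hJ : x ∈ (L.twist σ n).U J) :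
    (L.twist σ n).g I J ⟨x, Opens.mem_inf.2 ⟨hI, hJ⟩⟩ =
      ∏ k, L.g (I k) (J k) ⟨((σ ^ (k : ℕ) : VAut X) : Equiv.Perm X) x,
        Opens.mem_inf.2 ⟨mem_twist.1 hI k, mem_twist.1 hJ k⟩⟩ := rfl

theorem twist_g_add {m n : ℕ} (I J : Fin (m + n) → L.ι) (x : X)
    (hI : x ∈ (L.twist σ (m + n)).U I) (hJ : x ∈ (L.twist σ (m + n)).U J) :
    (L.twist σ (m + n)).g I J ⟨x, Opens.mem_inf.2 ⟨hI, hJ⟩⟩ =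
      (L.twist σ m).g (fun k => I (Fin.castAdd n k)) (fun k => J (Fin.castAdd n k))
        ⟨x, Opens.mem_inf.2 ⟨twist_left hI, twist_left hJ⟩⟩ *
      (L.twist σ n).g (fun k => I (Fin.natAdd m k)) (fun k => J (Fin.natAdd m k))
        ⟨((σ ^ m : VAut X) : Equiv.Perm X) x,
          Opens.mem_inf.2 ⟨twist_right hI, twist_right hJ⟩⟩ := by
  rw [twist_g I J x hI hJ, twist_g _ _ x (twist_left hI) (twist_left hJ),
    twist_g _ _ _ (twist_right hI) (twist_right hJ), Fin.prod_univ_add]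
  congr 1
  refine Finset.prod_congr rfl fun k _ => ?_
  congr 1
  exact Subtype.ext (act_add σ m k x)

/-- The multiplication `s * t = s ⊗ (σ^*)^m t` from `B_m × B_n` to `B_{m+n}`. -/
def twistedMul {m n : ℕ} (s : TwistedPiece L σ m) (t : TwistedPiece L σ n) :
    TwistedPiece L σ (m + n) :=
  ⟨fun I x =>
    s.1 (fun k => I (Fin.castAdd n k)) ⟨x, twist_left x.2⟩ *
    t.1 (fun k => I (Fin.natAdd m k))
      ⟨((σ ^ m : VAut X) : Equiv.Perm X) x, twist_right x.2⟩, by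
    refine ⟨fun I => mul_mem ?_ ?_, fun I J x hI hJ => ?_⟩
    · exact Variety.res (fun x hx => twist_left hx) (s.2.1 (fun k => I (Fin.castAdd n k)))
    · exact Variety.res (fun x hx => twist_right hx)
        ((σ ^ m).2.1.2 _ _ (t.2.1 (fun k => I (Fin.natAdd m k))))
    · have h1 := s.2.2 _ _ x (twist_left hI) (twist_left hJ)
      have h2 := t.2.2 _ _ _ (twist_right hI) (twist_right hJ)
      have h3 := twist_g_add I J x hI hJ
      exact (congrArg₂ (· * ·) h1 h2).trans ((mul_mul_mul_comm _ _ _ _).trans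
        (congrArg (· * _) h3.symm))⟩

theorem twistedMul_apply {m n : ℕ} (s : TwistedPiece L σ m) (t : TwistedPiece L σ n)
    (I : Fin (m + n) → L.ι) (x : X) (hx : x ∈ (L.twist σ (m + n)).U I) :
    (twistedMul s t).1 I ⟨x, hx⟩ =
      s.1 (fun k => I (Fin.castAdd n k)) ⟨x, twist_left hx⟩ *
      t.1 (fun k => I (Fin.natAdd m k))
        ⟨((σ ^ m : VAut X) : Equiv.Perm X) x, twist_right hx⟩ := rfl

/-- The scalars in `B_0 = H⁰(X, 𝒪)`. -/
def twistedScalar : ℂ →+ TwistedPiece L σ 0 where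
  toFun c := ⟨fun _ _ => c, fun I => Subalgebra.algebraMap_mem _ c, fun I J x hI hJ => by
    have h := twist_g (L := L) (σ := σ) I J x hI hJ
    rw [Fin.prod_univ_zero] at h
    exact ((congrArg (· * c) h).trans (one_mul c)).symm⟩
  map_zero' := rfl
  map_add' _ _ := rfl

theorem twistedScalar_apply (c : ℂ) (I : Fin 0 → L.ι) (x : X) (hx : x ∈ (L.twist σ 0).U I) :
    (twistedScalar (L := L) (σ := σ) c).1 I ⟨x, hx⟩ = c := rfl

theorem twisted_ext {m n : ℕ} (h : m = n) (s : TwistedPiece L σ m) (t : TwistedPiece L σ n)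
    (H : ∀ (I : Fin n → L.ι) (x : X) (hm : x ∈ (L.twist σ m).U (fun k => I (Fin.cast h k)))
      (hn : x ∈ (L.twist σ n).U I),
      s.1 (fun k => I (Fin.cast h k)) ⟨x, hm⟩ = t.1 I ⟨x, hn⟩) :
    GradedMonoid.mk (A := TwistedPiece L σ) m s = GradedMonoid.mk n t := by
  subst h
  congr 1
  apply Subtype.ext
  funext I x
  exact H I x x.2 x.2

theorem H0_congr {L : LineBundle X} (s : H0 L) {I J : L.ι} (h : I = J) {x y : X} (hxy : x = y)
    (hx : x ∈ L.U I) (hy : y ∈ L.U J) : s.1 I ⟨x, hx⟩ = s.1 J ⟨y, hy⟩ := by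
  subst h hxy
  rfl

instance : GradedMonoid.GMul (TwistedPiece L σ) where
  mul := twistedMul

instance : GradedMonoid.GOne (TwistedPiece L σ) where
  one := twistedScalar 1

instance : DirectSum.GSemiring (TwistedPiece L σ) where
  mul := twistedMul
  one := twistedScalar 1
  mul_zero s := Subtype.ext (by funext I x; exact mul_zero _)
  zero_mul s := Subtype.ext (by funext I x; exact zero_mul _)
  mul_add s t t' := Subtype.ext (by funext I x; exact mul_add _ _ _)
  add_mul s t t' := Subtype.ext (by funext I x; exact add_mul _ _ _)
  one_mul := by
    rintro ⟨n, t⟩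
    refine twisted_ext (zero_add n) (twistedMul (twistedScalar 1) t) t fun I x hm hn => ?_
    rw [twistedMul_apply, twistedScalar_apply, one_mul]
    refine H0_congr t (funext fun k => congrArg I (Fin.ext ?_)) rfl _ _
    simp
  mul_one := by
    rintro ⟨n, t⟩
    refine twisted_ext (add_zero n) (twistedMul t (twistedScalar 1)) t fun I x hm hn => ?_
    rw [twistedMul_apply, twistedScalar_apply, mul_one]
    exact H0_congr t (funext fun k => congrArg I (Fin.ext rfl)) rfl _ _
  mul_assoc := by
    rintro ⟨a, s⟩ ⟨b, t⟩ ⟨c, r⟩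
    refine twisted_ext (add_assoc a b c) (twistedMul (twistedMul s t) r)
      (twistedMul s (twistedMul t r)) fun I x hm hn => ?_
    simp only [twistedMul_apply, mul_assoc]
    congr 1
    congr 1
    refine H0_congr r (funext fun k => congrArg I (Fin.ext ?_)) (act_add σ a b x) _ _
    simp [add_assoc]
  natCast n := twistedScalar n
  natCast_zero := by
    rw [Nat.cast_zero, map_zero]
  natCast_succ n := by
    rw [Nat.cast_succ, map_add]

instance : DirectSum.GAlgebra ℂ (TwistedPiece L σ) where
  toFun := twistedScalar
  map_one := rfl
  map_mul c d := by
    refine twisted_ext (add_zero 0).symm (twistedScalar (c * d))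
      (twistedMul (twistedScalar c) (twistedScalar d)) fun I x hm hn => ?_
    rfl
  commutes := by
    rintro c ⟨n, t⟩
    refine twisted_ext (by rw [zero_add, add_zero]) (twistedMul (twistedScalar c) t)
      (twistedMul t (twistedScalar c)) fun I x hm hn => ?_
    rw [twistedMul_apply, twistedScalar_apply, twistedMul_apply, twistedScalar_apply, mul_comm]
    congr 1
    refine H0_congr t (funext fun k => congrArg I (Fin.ext ?_)) rfl _ _
    simp
  smul_def := by
    rintro c ⟨n, t⟩
    refine twisted_ext (zero_add n).symm (c • t) (twistedMul (twistedScalar c) t)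
      fun I x hm hn => ?_
    rw [twistedMul_apply, twistedScalar_apply]
    change c * _ = _
    congr 1
    refine H0_congr t (funext fun k => congrArg I (Fin.ext ?_)) rfl _ _
    simp

/-- The twisted homogeneous coordinate ring `B(X, L, σ) = ⨁ H⁰(X, L_n)`. -/
abbrev TwistedRing (L : LineBundle X) (σ : VAut X) : Type :=
  DirectSum ℕ (TwistedPiece L σ)

/-! ### The blow-up of the projective plane at three points -/

/-- The projective plane; its points also stand for the lines `{x | ∑ aⱼ xⱼ = 0}`, so that `x` lies
on the line `a` if and only if `x.orthogonal a`. -/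
abbrev Plane : Type := ℙ ℂ (Fin 3 → ℂ)

/-- The blow-up of the plane at `p 0`, `p 1`, `p 2`: the fibre product over the plane of the blow-ups
at the three points. The blow-up of the plane at a point `q` is the variety of pairs `(x, ℓ)` of a
point `x` and a line `ℓ` through `q` and `x`. The entry `b 0` is the point and `b 1`, `b 2`, `b 3`
are the lines. -/
def BlowUp (p : Fin 3 → Plane) : Type :=
  {b : Fin 4 → Plane // ∀ i : Fin 3, (p i).orthogonal (b i.succ) ∧ (b 0).orthogonal (b i.succ)}

/-- The multidegree of the `j`-th homogeneous coordinate of the `a`-th factor of `(ℙ²)⁴`. -/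
def multiWeight (aj : Fin 4 × Fin 3) : Fin 4 → ℕ := Pi.single aj.1 1

/-- Multihomogeneous forms of multidegree `d` on the blow-up, embedded in `(ℙ²)⁴`. -/
def blowUpForms (p : Fin 3 → Plane) (d : Fin 4 → ℕ) : Submodule ℂ (BlowUp p → ℂ) :=
  (MvPolynomial.weightedHomogeneousSubmodule ℂ multiWeight d).map
    (LinearMap.pi fun b : BlowUp p =>
      (MvPolynomial.aeval fun aj : Fin 4 × Fin 3 => (b.1 aj.1).rep aj.2).toLinearMap)

instance (p : Fin 3 → Plane) : SetLike.GradedMonoid (blowUpForms p) where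
  one_mem := ⟨1, MvPolynomial.isWeightedHomogeneous_one ℂ multiWeight, by
    funext b; simp⟩
  mul_mem := by
    rintro d e _ _ ⟨F, hF, rfl⟩ ⟨G, hG, rfl⟩
    exact ⟨F * G, MvPolynomial.IsWeightedHomogeneous.mul hF hG, by funext b; simp⟩

instance (p : Fin 3 → Plane) : TopologicalSpace (BlowUp p) := zariski (blowUpForms p)

instance (p : Fin 3 → Plane) : Variety (BlowUp p) := zariskiVariety (blowUpForms p)

/-- The exceptional curve over `p i`. -/
def exceptionalCurve (p : Fin 3 → Plane) (i : Fin 3) : Set (BlowUp p) := {b | b.1 0 = p i}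

/-- The strict transform of the line spanned by the two points `p j` with `j ≠ i`. -/
def lineCurve (p : Fin 3 → Plane) (i : Fin 3) : Set (BlowUp p) :=
  closure {b | ((b.1 0).submodule ≤ ⨆ j ∈ ({i}ᶜ : Set (Fin 3)), (p j).submodule) ∧
    ∀ j, b.1 0 ≠ p j}

/-- The hexagon `L₁, E₃, L₂, E₁, L₃, E₂` of `(-1)`-curves. -/
def hexagon (p : Fin 3 → Plane) : Fin 6 → Set (BlowUp p) :=
  ![lineCurve p 0, exceptionalCurve p 2, lineCurve p 1, exceptionalCurve p 0, lineCurve p 2,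
    exceptionalCurve p 1]

/-! ### Cox coordinates

The coordinates `X, Y, Z, s, t, u` are the entries `0, 1, 2, 3, 4, 5`. -/

/-- Points of `ℂ⁶` off the irrelevant locus: no two coordinates that belong to disjoint curves
vanish simultaneously. -/
def CoxSpace : Type :=
  {c : Fin 6 → ℂ //
    ¬ (c 0 = 0 ∧ c 4 = 0) ∧ ¬ (c 1 = 0 ∧ c 3 = 0) ∧ ¬ (c 2 = 0 ∧ c 5 = 0) ∧
    ¬ (c 0 = 0 ∧ c 1 = 0) ∧ ¬ (c 1 = 0 ∧ c 2 = 0) ∧ ¬ (c 2 = 0 ∧ c 0 = 0) ∧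
    ¬ (c 3 = 0 ∧ c 4 = 0) ∧ ¬ (c 5 = 0 ∧ c 4 = 0) ∧ ¬ (c 3 = 0 ∧ c 5 = 0)}

/-- Polynomial functions on `CoxSpace` (graded by the trivial monoid). -/
def coxForms (_ : PUnit) : Submodule ℂ (CoxSpace → ℂ) :=
  LinearMap.range (LinearMap.pi fun c : CoxSpace =>
    (MvPolynomial.aeval (R := ℂ) c.1).toLinearMap)

instance : SetLike.GradedMonoid coxForms where
  one_mem := ⟨1, by funext b; simp⟩
  mul_mem := by
    rintro d e _ _ ⟨F, rfl⟩ ⟨G, rfl⟩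
    exact ⟨F * G, by funext b; simp⟩

instance : TopologicalSpace CoxSpace := zariski coxForms

instance : Variety CoxSpace := zariskiVariety coxForms

/-- The map of `ℂ⁶ ∖ W` induced by the ring automorphism `X ↦ u ↦ Y ↦ t ↦ Z ↦ s ↦ X`, that is,
the value of a coordinate at `coxShift c` is the value of its image at `c`. -/
def coxShift (c : CoxSpace) : CoxSpace :=
  ⟨![c.1 5, c.1 4, c.1 3, c.1 0, c.1 2, c.1 1], by
    obtain ⟨c, h1, h2, h3, h4, h5, h6, h7, h8, h9⟩ := c
    exact ⟨fun h => h3 h.symm, fun h => h1 h.symm, fun h => h2 h.symm, fun h => h8 h,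
      fun h => h7 h.symm, fun h => h9 h, fun h => h6 h.symm, fun h => h5 h, fun h => h4 h⟩⟩

section CoxMap

variable {p : Fin 3 → Plane}

theorem comb_zero (hp : Projectivization.Independent p) {a b c : ℂ}
    (h : a • (p 0).rep + b • (p 1).rep + c • (p 2).rep = 0) : a = 0 ∧ b = 0 ∧ c = 0 := by
  have h1 := Fintype.linearIndependent_iff.1 (Projectivization.independent_iff.1 hp) ![a, b, c]
    (by simpa [Fin.sum_univ_three] using h)
  exact ⟨h1 0, h1 1, h1 2⟩

theorem cross_ne {v w : Fin 3 → ℂ} (h : ∀ a b : ℂ, a • v + b • w = 0 → a = 0 ∧ b = 0) :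
    crossProduct v w ≠ 0 :=
  crossProduct_ne_zero_iff_linearIndependent.2 (LinearIndependent.pair_iff.2 h)

/-- The image of `(X, Y, Z, s, t, u)` in the plane, in the frame given by `p`: `(Xsu, Ytu, Zst)`. -/
def coxPoint (p : Fin 3 → Plane) (c : CoxSpace) : Fin 3 → ℂ :=
  (c.1 0 * c.1 3 * c.1 5) • (p 0).rep + (c.1 1 * c.1 4 * c.1 5) • (p 1).rep +
    (c.1 2 * c.1 3 * c.1 4) • (p 2).rep

/-- The lines through `p i` and the point `coxPoint p c`, after removal of the common factors
`t`, `s`, `u` that vanish along the exceptional curves. -/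
def coxLine (p : Fin 3 → Plane) (c : CoxSpace) : Fin 3 → Fin 3 → ℂ :=
  ![crossProduct (p 0).rep ((c.1 1 * c.1 5) • (p 1).rep + (c.1 2 * c.1 3) • (p 2).rep),
    crossProduct (p 1).rep ((c.1 0 * c.1 5) • (p 0).rep + (c.1 2 * c.1 4) • (p 2).rep),
    crossProduct (p 2).rep ((c.1 0 * c.1 3) • (p 0).rep + (c.1 1 * c.1 4) • (p 1).rep)]

theorem coxPoint_ne (hp : Projectivization.Independent p) (c : CoxSpace) : coxPoint p c ≠ 0 := by
  intro h
  obtain ⟨h1, h2, h3⟩ := comb_zero hp h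
  obtain ⟨c, hc⟩ := c
  simp only [mul_eq_zero] at h1 h2 h3
  tauto

theorem coxLine_ne (hp : Projectivization.Independent p) (c : CoxSpace) (i : Fin 3) :
    coxLine p c i ≠ 0 := by
  obtain ⟨c, hc⟩ := c
  fin_cases i
  · refine cross_ne fun a b h => ?_
    obtain ⟨h1, h2, h3⟩ := comb_zero hp (a := a) (b := b * (c 1 * c 5)) (c := b * (c 2 * c 3))
      (by rw [← h]; module)
    simp only [mul_eq_zero] at h1 h2 h3
    tauto
  · refine cross_ne fun a b h => ?_
    obtain ⟨h1, h2, h3⟩ := comb_zero hp (a := b * (c 0 * c 5)) (b := a) (c := b * (c 2 * c 4))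
      (by rw [← h]; module)
    simp only [mul_eq_zero] at h1 h2 h3
    tauto
  · refine cross_ne fun a b h => ?_
    obtain ⟨h1, h2, h3⟩ := comb_zero hp (a := b * (c 0 * c 3)) (b := b * (c 1 * c 4)) (c := a)
      (by rw [← h]; module)
    simp only [mul_eq_zero] at h1 h2 h3
    tauto

/-- The quotient map `ℂ⁶ ∖ W → B₃`. -/
def coxMap (hp : Projectivization.Independent p) (c : CoxSpace) : BlowUp p :=
  ⟨Fin.cons (Projectivization.mk ℂ (coxPoint p c) (coxPoint_ne hp c))
    fun i => Projectivization.mk ℂ (coxLine p c i) (coxLine_ne hp c i), fun i => by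
    rw [Fin.cons_zero, Fin.cons_succ]
    constructor
    · rw [← Projectivization.mk_rep (p i), Projectivization.orthogonal_mk]
      fin_cases i <;> simp [coxLine, dotProduct, crossProduct, Fin.sum_univ_three] <;> ring
    · rw [Projectivization.orthogonal_mk]
      fin_cases i <;>
        simp [coxPoint, coxLine, dotProduct, crossProduct, Fin.sum_univ_three] <;> ring⟩

/-- A trivialization of the pull-back of `L` to `ℂ⁶ ∖ W`: nowhere vanishing regular functions `e i`
on the preimage of `U i` with `e j = g i j * e i`, so that the functions `s i * e i` of a section
`s` glue. The values of `e i` off the preimage of `U i` are irrelevant. -/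
structure CoxTrivialization (hp : Projectivization.Independent p) (L : LineBundle (BlowUp p)) where
  e : L.ι → CoxSpace → ℂ
  regular : ∀ i c, coxMap hp c ∈ L.U i → ∃ O : Opens CoxSpace, c ∈ O ∧
    (∀ c' ∈ O, coxMap hp c' ∈ L.U i) ∧ (fun c' : O => e i c') ∈ Variety.reg O
  ne_zero : ∀ i c, coxMap hp c ∈ L.U i → e i c ≠ 0
  compat : ∀ i j c (hi : coxMap hp c ∈ L.U i) (hj : coxMap hp c ∈ L.U j),
    e j c = L.g i j ⟨coxMap hp c, Opens.mem_inf.2 ⟨hi, hj⟩⟩ * e i c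

/-- The section `s` of `L ⊗ σ^* L ⊗ ⋯ ⊗ (σ^*)^(n-1) L`, pulled back to `ℂ⁶ ∖ W`, is the polynomial
`F` in the Cox coordinates. Here `(σ^*)^k L` is trivialized by the pull-back of the trivialization
of `L` under the `k`-th iterate of `coxShift`, which covers `σ ^ k`. -/
def CoxTrivialization.Represents {hp : Projectivization.Independent p} {L : LineBundle (BlowUp p)}
    (T : CoxTrivialization hp L) {σ : VAut (BlowUp p)} {n : ℕ} (s : TwistedPiece L σ n)
    (F : MvPolynomial (Fin 6) ℂ) : Prop :=
  ∀ (I : Fin n → L.ι) (c : CoxSpace) (h : coxMap hp c ∈ (L.twist σ n).U I),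
    s.1 I ⟨coxMap hp c, h⟩ * ∏ k : Fin n, T.e (I k) (coxShift^[(k : ℕ)] c) =
      MvPolynomial.eval c.1 F

end CoxMap

/-! ### The algebra `R` -/

/-- The relations `x⁵ = yxy` and `y² = xyx` between `x = ι 0` and `y = ι 1`. -/
inductive Rel : FreeAlgebra ℂ (Fin 2) → FreeAlgebra ℂ (Fin 2) → Prop
  | first : Rel (FreeAlgebra.ι ℂ 0 ^ 5)
      (FreeAlgebra.ι ℂ 1 * FreeAlgebra.ι ℂ 0 * FreeAlgebra.ι ℂ 1)
  | second : Rel (FreeAlgebra.ι ℂ 1 ^ 2)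
      (FreeAlgebra.ι ℂ 0 * FreeAlgebra.ι ℂ 1 * FreeAlgebra.ι ℂ 0)

/-- `R = ℂ⟨x, y⟩ / (x⁵ = yxy, y² = xyx)`. -/
abbrev AlgR : Type := RingQuot Rel

/-- The generators `x` (for `0`) and `y` (for `1`) of `R`. -/
def gen (i : Fin 2) : AlgR := RingQuot.mkAlgHom ℂ Rel (FreeAlgebra.ι ℂ i)

/-- The component of degree `n` of `R`, where `deg x = 1` and `deg y = 2`: the span of the words of
weight `n`. -/
def component (n : ℕ) : Submodule ℂ AlgR :=
  Submodule.span ℂ {r | ∃ w : List (Fin 2), (w.map ![1, 2]).sum = n ∧ r = (w.map gen).prod}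

end DelPezzo

end

open DelPezzo

/-
The shift of `ℂ⁶` maps fibres of `q` to fibres of `q`, hence descends to `B₃`. Since `q` has local
regular sections, a function on `B₃` is regular as soon as its pull-back along `q` is; this makes
the descended map an automorphism and lets `𝒪(L₁)` be glued from the frames `X`, `Zt/u`, `Yt/s` of
the trivial bundle upstairs.

As `W` has codimension two, the pull-backs to `ℂ⁶ ∖ W` of the sections of `ℒ_n` are polynomials,
and by the action of the torus they are spanned by the monomials of the degree of `ℒ_n`. In the
twisted ring, left multiplication by `x` and by `y` sends monomials to monomials, and for `n > 0`
each of these monomials is divisible by `X` or by `Zt`, so `x` and `y` generate. Conversely the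
relations `x⁵ = yxy` and `y² = xyx` reduce every word in `x` and `y` to a normal form determined by
its weight and its monomial, so there are no further relations.
-/

open scoped Topology

noncomputable section

namespace DelPezzo

/-! ### Regular maps -/

section RegularAt

variable {X Y : Type} [TopologicalSpace X]

theorem exists_extension {U : Opens X} (f : U → ℂ) : ∃ g : X → ℂ, ∀ x : U, f x = g x :=
  ⟨Function.extend (↑) f 0, fun x => (Subtype.val_injective.extend_apply f 0 x).symm⟩

variable [Variety X] [TopologicalSpace Y] [Variety Y]

/-- A function on a variety is regular at a point if it restricts to a regular function on a
neighbourhood of the point. Working with functions on the whole space avoids carrying the domains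
of sections around; the values far from the point are irrelevant. -/
def RegularAt (f : X → ℂ) (x : X) : Prop :=
  ∃ U : Opens X, x ∈ U ∧ (fun y : U => f y) ∈ Variety.reg U

theorem regularAt_of_mem_reg {U : Opens X} {f : U → ℂ} (hf : f ∈ Variety.reg U) {g : X → ℂ}
    (hfg : ∀ x : U, f x = g x) {x : X} (hx : x ∈ U) : RegularAt g x :=
  ⟨U, hx, by rwa [← funext hfg]⟩

theorem mem_reg_of_regularAt {U : Opens X} {f : U → ℂ} {g : X → ℂ} (hfg : ∀ x : U, f x = g x)
    (h : ∀ x ∈ U, RegularAt g x) : f ∈ Variety.reg U := by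
  refine Variety.glue fun x => ?_
  obtain ⟨V, hxV, hV⟩ := h x x.2
  refine ⟨V ⊓ U, inf_le_right, ⟨hxV, x.2⟩, ?_⟩
  simpa only [hfg] using Variety.res (inf_le_left : V ⊓ U ≤ V) hV

theorem regularAt_const (a : ℂ) (x : X) : RegularAt (fun _ => a) x :=
  ⟨⊤, trivial, Subalgebra.algebraMap_mem (Variety.reg ⊤) a⟩

namespace RegularAt

variable {f g : X → ℂ} {x : X}

theorem congr (hf : RegularAt f x) (h : f =ᶠ[𝓝 x] g) : RegularAt g x := by
  obtain ⟨U, hxU, hU⟩ := hf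
  obtain ⟨V, hV, hVo, hxV⟩ := eventually_nhds_iff.1 h
  refine ⟨⟨V, hVo⟩ ⊓ U, ⟨hxV, hxU⟩, ?_⟩
  convert Variety.res (inf_le_right : (⟨V, hVo⟩ : Opens X) ⊓ U ≤ U) hU using 1
  exact funext fun y => (hV y y.2.1).symm

theorem exists_common (hf : RegularAt f x) (hg : RegularAt g x) :
    ∃ U : Opens X, x ∈ U ∧ (fun y : U => f y) ∈ Variety.reg U ∧
      (fun y : U => g y) ∈ Variety.reg U := by
  obtain ⟨U, hxU, hU⟩ := hf
  obtain ⟨V, hxV, hV⟩ := hg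
  exact ⟨U ⊓ V, ⟨hxU, hxV⟩, Variety.res inf_le_left hU, Variety.res inf_le_right hV⟩

theorem add (hf : RegularAt f x) (hg : RegularAt g x) : RegularAt (fun y => f y + g y) x := by
  obtain ⟨U, hx, hfU, hgU⟩ := hf.exists_common hg
  exact ⟨U, hx, add_mem hfU hgU⟩

theorem mul (hf : RegularAt f x) (hg : RegularAt g x) : RegularAt (fun y => f y * g y) x := by
  obtain ⟨U, hx, hfU, hgU⟩ := hf.exists_common hg
  exact ⟨U, hx, mul_mem hfU hgU⟩

theorem neg (hf : RegularAt f x) : RegularAt (fun y => -f y) x := by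
  simpa only [neg_one_mul] using (regularAt_const (-1) x).mul hf

theorem update {ι : Type*} [DecidableEq ι] (hf : RegularAt f x) (v : ι → ℂ) (i j : ι) :
    RegularAt (fun y => Function.update v i (f y) j) x := by
  obtain rfl | hj := eq_or_ne j i
  · simpa only [Function.update_self] using hf
  · simpa only [Function.update_of_ne hj] using regularAt_const (v j) x

theorem prod {ι : Type*} {s : Finset ι} {f : ι → X → ℂ} (h : ∀ i ∈ s, RegularAt (f i) x) :
    RegularAt (fun y => ∏ i ∈ s, f i y) x := by
  classical
  induction s using Finset.induction_on with
  | empty => simpa using regularAt_const 1 x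
  | insert i s hi ih =>
    simp only [Finset.prod_insert hi]
    exact (h i (Finset.mem_insert_self i s)).mul
      (ih fun j hj => h j (Finset.mem_insert_of_mem hj))

theorem eval {σ : Type*} {s : X → σ → ℂ} (hs : ∀ j, RegularAt (fun y => s y j) x)
    (F : MvPolynomial σ ℂ) : RegularAt (fun y => MvPolynomial.eval (s y) F) x := by
  induction F using MvPolynomial.induction_on with
  | C a => simpa using regularAt_const a x
  | add F G hF hG => simpa using hF.add hG
  | mul_X F j hF => simpa using hF.mul (hs j)

end RegularAt

theorem isMorphism_of_regularAt {φ : X → Y} (hφ : Continuous φ)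
    (h : ∀ (f : Y → ℂ) (x : X), RegularAt f (φ x) → RegularAt (f ∘ φ) x) : IsMorphism φ := by
  refine ⟨hφ, fun U f hf => ?_⟩
  obtain ⟨g, hg⟩ := exists_extension f
  exact mem_reg_of_regularAt (g := g ∘ φ) (fun x => hg ⟨φ x, x.2⟩)
    fun x hx => h g x (regularAt_of_mem_reg hf hg hx)

theorem IsMorphism.regularAt_comp {φ : X → Y} (hφ : IsMorphism φ) {f : Y → ℂ} {x : X}
    (hf : RegularAt f (φ x)) : RegularAt (f ∘ φ) x := by
  obtain ⟨hc, h⟩ := hφ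
  obtain ⟨U, hxU, hU⟩ := hf
  exact ⟨Opens.comap ⟨φ, hc⟩ U, hxU, h U _ hU⟩

theorem IsMorphism.iterate {φ : X → X} (h : IsMorphism φ) (n : ℕ) : IsMorphism φ^[n] := by
  induction n with
  | zero => exact isMorphism_of_regularAt continuous_id fun _ _ hf => hf
  | succ n ih =>
    exact isMorphism_of_regularAt (ih.1.comp h.1) fun f _ hf =>
      h.regularAt_comp (f := f ∘ φ^[n]) (ih.regularAt_comp hf)

/-- The stalks of the sheaf of regular functions are local rings: a function that is regular at a
point and does not vanish there is a unit near the point. -/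
class IsLocallyRinged (X : Type) [TopologicalSpace X] [Variety X] : Prop where
  eventually_ne_zero {f : X → ℂ} {x : X} : RegularAt f x → f x ≠ 0 → ∀ᶠ y in 𝓝 x, f y ≠ 0
  inv {f : X → ℂ} {x : X} : RegularAt f x → f x ≠ 0 → RegularAt (fun y => (f y)⁻¹) x

section IsLocallyRinged

variable [IsLocallyRinged X] {f g : X → ℂ} {x : X}

theorem RegularAt.eventually_ne_zero (hf : RegularAt f x) (h0 : f x ≠ 0) : ∀ᶠ y in 𝓝 x, f y ≠ 0 :=
  IsLocallyRinged.eventually_ne_zero hf h0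

theorem RegularAt.inv (hf : RegularAt f x) (h0 : f x ≠ 0) : RegularAt (fun y => (f y)⁻¹) x :=
  IsLocallyRinged.inv hf h0

theorem RegularAt.div (hf : RegularAt f x) (hg : RegularAt g x) (h0 : g x ≠ 0) :
    RegularAt (fun y => f y / g y) x := by
  simpa only [div_eq_mul_inv] using hf.mul (hg.inv h0)

end IsLocallyRinged

end RegularAt

section Zariski

variable {X D : Type} {𝒜 : D → Submodule ℂ (X → ℂ)}

theorem isOpen_nonvanishing {d : D} {G : X → ℂ} (hG : G ∈ 𝒜 d) :
    IsOpen[zariski 𝒜] {x | G x ≠ 0} :=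
  TopologicalSpace.GenerateOpen.basic _ ⟨d, G, hG, rfl⟩

variable [AddCommMonoid D] [SetLike.GradedMonoid 𝒜]

theorem mem_nhds_zariski_iff {s : Set X} {x : X} :
    s ∈ @nhds X (zariski 𝒜) x ↔ ∃ d, ∃ G ∈ 𝒜 d, G x ≠ 0 ∧ ∀ y, G y ≠ 0 → y ∈ s := by
  let := zariski 𝒜
  constructor
  · intro hs
    obtain ⟨O, hOs, hO, hx⟩ := mem_nhds_iff.1 hs
    suffices ∃ d, ∃ G ∈ 𝒜 d, G x ≠ 0 ∧ ∀ y, G y ≠ 0 → y ∈ O from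
      let ⟨d, G, hG, hGx, h⟩ := this
      ⟨d, G, hG, hGx, fun y hy => hOs (h y hy)⟩
    clear hs hOs
    induction hO with
    | basic O hO =>
      obtain ⟨d, G, hG, rfl⟩ := hO
      exact ⟨d, G, hG, hx, fun y hy => hy⟩
    | univ => exact ⟨0, 1, SetLike.one_mem_graded 𝒜, one_ne_zero, fun _ _ => trivial⟩
    | inter O O' _ _ hO hO' =>
      obtain ⟨d, G, hG, hGx, hGO⟩ := hO hx.1
      obtain ⟨e, H, hH, hHx, hHO'⟩ := hO' hx.2
      exact ⟨d + e, G * H, SetLike.mul_mem_graded hG hH, mul_ne_zero hGx hHx, fun y hy =>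
        ⟨hGO y (left_ne_zero_of_mul hy), hHO' y (right_ne_zero_of_mul hy)⟩⟩
    | sUnion S _ hS =>
      obtain ⟨O, hO, hxO⟩ := hx
      obtain ⟨d, G, hG, hGx, hGO⟩ := hS O hO hxO
      exact ⟨d, G, hG, hGx, fun y hy => ⟨O, hO, hGO y hy⟩⟩
  · rintro ⟨d, G, hG, hGx, h⟩
    exact mem_nhds_iff.2 ⟨_, h, isOpen_nonvanishing hG, hGx⟩

theorem regularAt_zariski_iff {f : X → ℂ} {x : X} :
    @RegularAt X (zariski 𝒜) (zariskiVariety 𝒜) f x ↔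
      ∃ d, ∃ F ∈ 𝒜 d, ∃ G ∈ 𝒜 d, G x ≠ 0 ∧ ∀ᶠ y in @nhds X (zariski 𝒜) x, f y = F y / G y := by
  let := zariski 𝒜
  let := zariskiVariety 𝒜
  constructor
  · rintro ⟨U, hxU, hU⟩
    obtain ⟨V, hxV, d, F, hF, G, hG, h⟩ := hU ⟨x, hxU⟩
    refine ⟨d, F, hF, G, hG, (h ⟨x, hxU⟩ hxV).1, ?_⟩
    filter_upwards [U.2.mem_nhds hxU, V.2.mem_nhds hxV] with y hyU hyV
    exact (h ⟨y, hyU⟩ hyV).2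
  · rintro ⟨d, F, hF, G, hG, hGx, h⟩
    refine RegularAt.congr ?_ (h.mono fun _ => Eq.symm)
    exact ⟨⟨_, isOpen_nonvanishing hG⟩, hGx, fun y =>
      ⟨⊤, trivial, d, F, hF, G, hG, fun z _ => ⟨z.2, rfl⟩⟩⟩

theorem isLocallyRinged_zariski : @IsLocallyRinged X (zariski 𝒜) (zariskiVariety 𝒜) := by
  let := zariski 𝒜
  let := zariskiVariety 𝒜
  have key : ∀ {f : X → ℂ} {x : X}, RegularAt f x → f x ≠ 0 →
      ∃ d, ∃ F ∈ 𝒜 d, ∃ G ∈ 𝒜 d, F x ≠ 0 ∧ G x ≠ 0 ∧ ∀ᶠ y in 𝓝 x, f y = F y / G y := by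
    intro f x hf h0
    obtain ⟨d, F, hF, G, hG, hGx, h⟩ := regularAt_zariski_iff.1 hf
    refine ⟨d, F, hF, G, hG, fun hFx => h0 ?_, hGx, h⟩
    rw [h.self_of_nhds, hFx, zero_div]
  constructor
  · intro f x hf h0
    obtain ⟨d, F, hF, G, hG, hFx, hGx, h⟩ := key hf h0
    filter_upwards [h, (isOpen_nonvanishing hF).mem_nhds hFx,
      (isOpen_nonvanishing hG).mem_nhds hGx] with y hy hFy hGy
    rw [hy]
    exact div_ne_zero hFy hGy
  · intro f x hf h0
    obtain ⟨d, F, hF, G, hG, hFx, -, h⟩ := key hf h0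
    refine regularAt_zariski_iff.2 ⟨d, G, hG, F, hF, hFx, h.mono fun y hy => ?_⟩
    rw [hy, inv_div]

end Zariski

instance (p : Fin 3 → Plane) : IsLocallyRinged (BlowUp p) := isLocallyRinged_zariski

instance : IsLocallyRinged CoxSpace := isLocallyRinged_zariski

open Matrix MvPolynomial

/-! ### Cox coordinates as charts of the blow-up -/

section CoxSpace

theorem regularAt_cox_iff {f : CoxSpace → ℂ} {c : CoxSpace} :
    RegularAt f c ↔ ∃ F G : MvPolynomial (Fin 6) ℂ, eval c.1 G ≠ 0 ∧
      ∀ᶠ c' in 𝓝 c, f c' = eval c'.1 F / eval c'.1 G := by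
  refine regularAt_zariski_iff.trans ⟨?_, ?_⟩
  · rintro ⟨-, _, ⟨F, rfl⟩, _, ⟨G, rfl⟩, h⟩
    exact ⟨F, G, h⟩
  · rintro ⟨F, G, h⟩
    exact ⟨⟨⟩, _, ⟨F, rfl⟩, _, ⟨G, rfl⟩, h⟩

theorem isOpen_eval_ne_zero (F : MvPolynomial (Fin 6) ℂ) :
    IsOpen {c : CoxSpace | eval c.1 F ≠ 0} :=
  isOpen_nonvanishing (𝒜 := coxForms) (d := ⟨⟩) ⟨F, rfl⟩

theorem mem_nhds_cox_iff {s : Set CoxSpace} {c : CoxSpace} :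
    s ∈ 𝓝 c ↔ ∃ F : MvPolynomial (Fin 6) ℂ, eval c.1 F ≠ 0 ∧ ∀ c', eval c'.1 F ≠ 0 → c' ∈ s := by
  refine mem_nhds_zariski_iff.trans ⟨?_, ?_⟩
  · rintro ⟨-, _, ⟨F, rfl⟩, h⟩
    exact ⟨F, h⟩
  · rintro ⟨F, h⟩
    exact ⟨⟨⟩, _, ⟨F, rfl⟩, h⟩

theorem regularAt_eval (F : MvPolynomial (Fin 6) ℂ) (c : CoxSpace) :
    RegularAt (fun c' : CoxSpace => eval c'.1 F) c :=
  regularAt_cox_iff.2 ⟨F, 1, by simp, .of_forall fun c' => by simp⟩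

variable {X : Type} [TopologicalSpace X] [Variety X] [IsLocallyRinged X] {s : X → CoxSpace} {x : X}

theorem continuousAt_of_regularAt (hs : ∀ j, RegularAt (fun y => (s y).1 j) x) :
    ContinuousAt s x := by
  intro U hU
  obtain ⟨F, hF, hU⟩ := mem_nhds_cox_iff.1 hU
  exact ((RegularAt.eval hs F).eventually_ne_zero hF).mono fun y hy => hU _ hy

theorem RegularAt.comp_cox {f : CoxSpace → ℂ} (hf : RegularAt f (s x))
    (hs : ∀ j, RegularAt (fun y => (s y).1 j) x) : RegularAt (f ∘ s) x := by
  obtain ⟨F, G, hG, h⟩ := regularAt_cox_iff.1 hf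
  refine ((RegularAt.eval hs F).div (RegularAt.eval hs G) hG).congr ?_
  filter_upwards [continuousAt_of_regularAt hs h] with y hy using hy.symm

end CoxSpace

section Coordinates

variable {p : Fin 3 → Plane}

/-- The matrix whose rows are the vectors `vᵢ` chosen to represent the points `pᵢ`. -/
def frame (p : Fin 3 → Plane) : Matrix (Fin 3) (Fin 3) ℂ :=
  .of fun i => (p i).rep

theorem det_frame_ne_zero (hp : Projectivization.Independent p) : (frame p).det ≠ 0 :=
  ((isUnit_iff_isUnit_det _).1
    (linearIndependent_rows_iff_isUnit.1 (Projectivization.independent_iff.1 hp))).ne_zero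

/-- The matrices that pass from the standard homogeneous coordinates on the four planes to the
coordinates with respect to the frame `p`, for the plane of points, respectively to those with
respect to the dual frame, for the three planes of lines, up to a common factor. -/
def coordMatrix (p : Fin 3 → Plane) : Fin 4 → Matrix (Fin 3) (Fin 3) ℂ :=
  Fin.cons (frame p)ᵀ.adjugate fun _ => frame p

theorem det_coordMatrix_ne_zero (hp : Projectivization.Independent p) (a : Fin 4) :
    (coordMatrix p a).det ≠ 0 := by
  cases a using Fin.cases with
  | zero => simpa [coordMatrix, det_adjugate] using det_frame_ne_zero hp
  | succ i => exact det_frame_ne_zero hp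

/-- The `j`-th homogeneous coordinate of the point (`a = 0`) or of the line (`a = 1, 2, 3`) that is
the `a`-th entry of `b`, with respect to `coordMatrix`. -/
def coordForm (p : Fin 3 → Plane) (a : Fin 4) (j : Fin 3) (b : BlowUp p) : ℂ :=
  (coordMatrix p a *ᵥ (b.1 a).rep) j

theorem coordForm_mem (a : Fin 4) (j : Fin 3) :
    coordForm p a j ∈ blowUpForms p (Pi.single a 1) := by
  refine ⟨∑ l, C (coordMatrix p a j l) * X (a, l), ?_, ?_⟩
  · exact IsWeightedHomogeneous.sum _ _ _ fun l _ =>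
      (isWeightedHomogeneous_X ℂ multiWeight (a, l)).C_mul _
  · funext b
    simp [coordForm, mulVec, dotProduct]

theorem regularAt_coordForm_div {a : Fin 4} {j k : Fin 3} {b : BlowUp p}
    (hb : coordForm p a k b ≠ 0) :
    RegularAt (fun b => coordForm p a j b / coordForm p a k b) b :=
  regularAt_zariski_iff.2
    ⟨_, _, coordForm_mem a j, _, coordForm_mem a k, hb, .of_forall fun _ => rfl⟩

theorem exists_coordForm_ne_zero (hp : Projectivization.Independent p) (a : Fin 4) (b : BlowUp p) :
    ∃ j, coordForm p a j b ≠ 0 := by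
  by_contra! h
  exact (b.1 a).rep_nonzero
    (eq_zero_of_mulVec_eq_zero (det_coordMatrix_ne_zero hp a) (funext h))

theorem orthogonal_iff_rep {x y : Plane} : x.orthogonal y ↔ x.rep ⬝ᵥ y.rep = 0 := by
  conv_lhs => rw [← x.mk_rep, ← y.mk_rep]
  exact Projectivization.orthogonal_mk _ _

theorem coordForm_succ_self (b : BlowUp p) (i : Fin 3) : coordForm p i.succ i b = 0 :=
  orthogonal_iff_rep.1 (b.2 i).1

theorem sum_coordForm_mul_coordForm (b : BlowUp p) (i : Fin 3) :
    ∑ j, coordForm p 0 j b * coordForm p i.succ j b = 0 := by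
  change ((frame p)ᵀ.adjugate *ᵥ (b.1 0).rep) ⬝ᵥ (frame p *ᵥ (b.1 i.succ).rep) = 0
  rw [← adjugate_transpose, mulVec_transpose, ← dotProduct_mulVec, mulVec_mulVec, adjugate_mul,
    smul_mulVec, one_mulVec, dotProduct_smul, orthogonal_iff_rep.1 (b.2 i).2, smul_zero]

theorem mk_eq_mk_of_mulVec {K n : Type*} [Field K] [Fintype n] [DecidableEq n] {A : Matrix n n K}
    (hA : A.det ≠ 0) {v w : n → K} (hv : v ≠ 0) (hw : w ≠ 0)
    (h : ∀ i j, (A *ᵥ v) i * (A *ᵥ w) j = (A *ᵥ v) j * (A *ᵥ w) i) :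
    Projectivization.mk K v hv = Projectivization.mk K w hw := by
  obtain ⟨k, hk⟩ := Function.ne_iff.1 fun h0 => hw (eq_zero_of_mulVec_eq_zero hA h0)
  have hvw : (A *ᵥ w) k • v = (A *ᵥ v) k • w := by
    refine mulVec_injective_of_isUnit ((isUnit_iff_isUnit_det A).2 hA.isUnit) (funext fun j => ?_)
    simpa [mulVec_smul, mul_comm] using h j k
  refine (Projectivization.mk_eq_mk_iff' K v w hv hw).2 ⟨(A *ᵥ v) k / (A *ᵥ w) k, ?_⟩
  rw [div_eq_inv_mul, mul_smul, ← hvw, inv_smul_smul₀ hk]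

/-- The coordinates of `coxMap hp c` with respect to `coordMatrix`, as monomials in the Cox
coordinates; see `coordForm_coxMap`. -/
def coxMonomial : Fin 4 → Fin 3 → MvPolynomial (Fin 6) ℂ :=
  ![![X 0 * X 3 * X 5, X 1 * X 4 * X 5, X 2 * X 3 * X 4], ![0, -(X 2 * X 3), X 1 * X 5],
    ![X 2 * X 4, 0, -(X 0 * X 5)], ![-(X 1 * X 4), X 0 * X 3, 0]]

/-- The vectors that represent the entries of `coxMap hp c`. -/
def coxVec (p : Fin 3 → Plane) (c : CoxSpace) : Fin 4 → Fin 3 → ℂ :=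
  Fin.cons (coxPoint p c) (coxLine p c)

theorem coordMatrix_mulVec_coxVec (c : CoxSpace) (a : Fin 4) :
    coordMatrix p a *ᵥ coxVec p c a = (frame p).det • fun j => eval c.1 (coxMonomial a j) := by
  cases a using Fin.cases with
  | zero =>
    have : coxPoint p c = (frame p)ᵀ *ᵥ fun j => eval c.1 (coxMonomial 0 j) := by
      rw [mulVec_eq_sum]
      simp [Fin.sum_univ_three, coxPoint, coxMonomial, frame]
      rfl
    rw [coordMatrix, coxVec, Fin.cons_zero, Fin.cons_zero, this, mulVec_mulVec, adjugate_mul,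
      det_transpose, smul_mulVec, one_mulVec]
  | succ i =>
    rw [coordMatrix, coxVec, Fin.cons_succ, Fin.cons_succ, det_fin_three]
    ext j
    fin_cases i <;> fin_cases j <;>
      simp [coxLine, coxMonomial, frame, mulVec, dotProduct, crossProduct, Fin.sum_univ_three] <;>
      ring

theorem exists_rep_coxMap (hp : Projectivization.Independent p) (c : CoxSpace) :
    ∃ κ : Fin 4 → ℂ, (∀ a, κ a ≠ 0) ∧ ∀ a, ((coxMap hp c).1 a).rep = κ a • coxVec p c a := by
  have h : ∀ a, ∃ κ : ℂˣ, κ • coxVec p c a = ((coxMap hp c).1 a).rep := fun a => by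
    cases a using Fin.cases with
    | zero => exact Projectivization.exists_smul_eq_mk_rep ℂ _ (coxPoint_ne hp c)
    | succ i => exact Projectivization.exists_smul_eq_mk_rep ℂ _ (coxLine_ne hp c i)
  choose κ hκ using h
  exact ⟨fun a => κ a, fun a => (κ a).ne_zero, fun a => (hκ a).symm⟩

theorem coordForm_coxMap (hp : Projectivization.Independent p) (c : CoxSpace) :
    ∃ κ : Fin 4 → ℂ, (∀ a, κ a ≠ 0) ∧
      ∀ a j, coordForm p a j (coxMap hp c) = κ a * eval c.1 (coxMonomial a j) := by
  obtain ⟨κ, hκ0, hκ⟩ := exists_rep_coxMap hp c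
  refine ⟨fun a => κ a * (frame p).det, fun a => mul_ne_zero (hκ0 a) (det_frame_ne_zero hp),
    fun a j => ?_⟩
  rw [coordForm, hκ, mulVec_smul, coordMatrix_mulVec_coxVec]
  simp [mul_assoc]

theorem coxMap_eq_iff (hp : Projectivization.Independent p) {c : CoxSpace} {b : BlowUp p} :
    coxMap hp c = b ↔ ∀ a i j, eval c.1 (coxMonomial a i) * coordForm p a j b =
      eval c.1 (coxMonomial a j) * coordForm p a i b := by
  constructor
  · rintro rfl a i j
    obtain ⟨κ, -, h⟩ := coordForm_coxMap hp c
    rw [h, h]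
    ring
  · intro h
    refine Subtype.ext (funext fun a => ?_)
    obtain ⟨κ, -, hκ⟩ := coordForm_coxMap hp c
    rw [← ((coxMap hp c).1 a).mk_rep, ← (b.1 a).mk_rep]
    refine mk_eq_mk_of_mulVec (det_coordMatrix_ne_zero hp a) _ _ fun i j => ?_
    change coordForm p a i _ * coordForm p a j b = coordForm p a j _ * coordForm p a i b
    rw [hκ, hκ, mul_assoc, h a i j, mul_assoc]

end Coordinates

section PullBack

variable {p : Fin 3 → Plane}

theorem eval_mul_of_isWeightedHomogeneous {P : MvPolynomial (Fin 4 × Fin 3) ℂ} {d : Fin 4 → ℕ}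
    (hP : IsWeightedHomogeneous multiWeight P d) (κ : Fin 4 → ℂ) (z : Fin 4 × Fin 3 → ℂ) :
    eval (fun aj => κ aj.1 * z aj) P = (∏ a, κ a ^ d a) * eval z P := by
  rw [eval_eq, eval_eq, Finset.mul_sum]
  refine Finset.sum_congr rfl fun m hm => ?_
  have hκ : ∏ i ∈ m.support, κ i.1 ^ m i = ∏ a, κ a ^ d a := by
    simp only [← hP (mem_support_iff.1 hm), Finsupp.weight_apply, Finsupp.sum, Finset.sum_apply,
      ← Finset.prod_pow_eq_pow_sum]
    rw [Finset.prod_comm]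
    refine Finset.prod_congr rfl fun i _ => ?_
    rw [Finset.prod_eq_single i.1 (fun a _ ha => by simp [multiWeight, Pi.single_eq_of_ne ha])
      (by simp)]
    simp [multiWeight]
  simp only [mul_pow, Finset.prod_mul_distrib, hκ]
  ring

theorem exists_polynomial_coxVec (hp : Projectivization.Independent p) (a : Fin 4) (j : Fin 3) :
    ∃ P : MvPolynomial (Fin 6) ℂ, ∀ c : CoxSpace, eval c.1 P = coxVec p c a j := by
  refine ⟨∑ i, C ((frame p).det * (coordMatrix p a)⁻¹ j i) * coxMonomial a i, fun c => ?_⟩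
  have h : coxVec p c a =
      (frame p).det • (coordMatrix p a)⁻¹ *ᵥ fun j => eval c.1 (coxMonomial a j) := by
    rw [← mulVec_smul, ← coordMatrix_mulVec_coxVec, mulVec_mulVec,
      nonsing_inv_mul _ (det_coordMatrix_ne_zero hp a).isUnit, one_mulVec]
  rw [h]
  simp only [map_sum, map_mul, eval_C, mul_assoc, ← Finset.mul_sum]
  rfl

theorem exists_pullback_form (hp : Projectivization.Independent p) (d : Fin 4 → ℕ) :
    ∃ κ : CoxSpace → ℂ, (∀ c, κ c ≠ 0) ∧ ∀ F ∈ blowUpForms p d,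
      ∃ P : MvPolynomial (Fin 6) ℂ, ∀ c, F (coxMap hp c) = κ c * eval c.1 P := by
  choose κ hκ0 hκ using exists_rep_coxMap hp
  refine ⟨fun c => ∏ a, κ c a ^ d a,
    fun c => Finset.prod_ne_zero_iff.2 fun a _ => pow_ne_zero _ (hκ0 c a), ?_⟩
  rintro _ ⟨Q, hQ, rfl⟩
  choose v hv using exists_polynomial_coxVec hp
  refine ⟨bind₁ (fun aj => v aj.1 aj.2) Q, fun c => ?_⟩
  have hrep (aj : Fin 4 × Fin 3) :
      ((coxMap hp c).1 aj.1).rep aj.2 = κ c aj.1 * eval c.1 (v aj.1 aj.2) := by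
    rw [hκ, hv]
    rfl
  calc aeval (fun aj : Fin 4 × Fin 3 => ((coxMap hp c).1 aj.1).rep aj.2) Q
      = eval (fun aj => κ c aj.1 * eval c.1 (v aj.1 aj.2)) Q := by
        simp only [hrep, aeval_eq_eval]
    _ = (∏ a, κ c a ^ d a) * eval (fun aj => eval c.1 (v aj.1 aj.2)) Q :=
        eval_mul_of_isWeightedHomogeneous hQ _ _
    _ = _ := congrArg _ (eval₂Hom_bind₁ (RingHom.id ℂ) c.1 _ Q).symm

theorem continuous_coxMap (hp : Projectivization.Independent p) : Continuous (coxMap hp) := by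
  refine continuous_generateFrom_iff.2 ?_
  rintro _ ⟨d, G, hG, rfl⟩
  obtain ⟨κ, hκ, h⟩ := exists_pullback_form hp d
  obtain ⟨Q, hQ⟩ := h G hG
  convert isOpen_eval_ne_zero Q using 1
  ext c
  simp [hQ, hκ]

theorem isMorphism_coxMap (hp : Projectivization.Independent p) : IsMorphism (coxMap hp) := by
  refine isMorphism_of_regularAt (continuous_coxMap hp) fun f c hf => ?_
  obtain ⟨d, F, hF, G, hG, hG0, hfFG⟩ := regularAt_zariski_iff.1 hf
  obtain ⟨κ, hκ, h⟩ := exists_pullback_form hp d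
  obtain ⟨P, hP⟩ := h F hF
  obtain ⟨Q, hQ⟩ := h G hG
  refine regularAt_cox_iff.2 ⟨P, Q, fun h0 => hG0 (by rw [hQ, h0, mul_zero]), ?_⟩
  filter_upwards [(continuous_coxMap hp).continuousAt.eventually hfFG] with c' hc'
  rw [Function.comp_apply, hc', hP, hQ, mul_div_mul_left _ _ (hκ c')]

end PullBack

section LocalSection

variable {p : Fin 3 → Plane}

/-- The point of `ℂ⁶` with `X, Y, Z = A 0, A 1, A 2` and `t, s, u = e 0, e 1, e 2`. -/
def coxTuple (A e : Fin 3 → ℂ) : Fin 6 → ℂ :=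
  ![A 0, A 1, A 2, e 1, e 0, e 2]

section Distinct

variable {i j k : Fin 3}

theorem forall_iff_of_distinct (hij : i ≠ j) (hik : i ≠ k) (hjk : j ≠ k) {P : Fin 3 → Prop} :
    (∀ l, P l) ↔ P i ∧ P j ∧ P k := by
  have h : ∀ l, l = i ∨ l = j ∨ l = k := by decide +revert
  exact ⟨fun H => ⟨H i, H j, H k⟩, fun H l => by rcases h l with rfl | rfl | rfl <;> tauto⟩

theorem sum_of_distinct {M : Type*} [AddCommMonoid M] (hij : i ≠ j) (hik : i ≠ k) (hjk : j ≠ k)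
    (f : Fin 3 → M) : ∑ l, f l = f i + f j + f k := by
  have h : (Finset.univ : Finset (Fin 3)) = {i, j, k} := by decide +revert
  rw [h, Finset.sum_insert (by simp [hij, hik]), Finset.sum_pair hjk, add_assoc]

theorem eval_coxMonomial_zero (A e : Fin 3 → ℂ) (hij : i ≠ j) (hik : i ≠ k) (hjk : j ≠ k) :
    eval (coxTuple A e) (coxMonomial 0 i) = A i * e j * e k := by
  fin_cases i <;> fin_cases j <;> fin_cases k <;> first | contradiction | skip
  all_goals
    simp [coxTuple, coxMonomial]
    try ring

theorem exists_eval_coxMonomial_succ (A e : Fin 3 → ℂ) (hij : i ≠ j) (hik : i ≠ k) (hjk : j ≠ k) :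
    ∃ ε : ℂ, ε * ε = 1 ∧ eval (coxTuple A e) (coxMonomial i.succ i) = 0 ∧
      eval (coxTuple A e) (coxMonomial i.succ j) = ε * (A k * e j) ∧
      eval (coxTuple A e) (coxMonomial i.succ k) = -ε * (A j * e k) := by
  fin_cases i <;> fin_cases j <;> fin_cases k <;> first | contradiction | skip
  all_goals
    first
      | refine ⟨1, ?_⟩; simp [coxTuple, coxMonomial]; done
      | refine ⟨-1, ?_⟩; simp [coxTuple, coxMonomial]

end Distinct

theorem exists_smul_coxMonomial {z : Fin 4 → Fin 3 → ℂ} (h0 : ∀ i, z i.succ i = 0)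
    (hz : ∀ i : Fin 3, ∑ j, z 0 j * z i.succ j = 0) {i j k : Fin 3} (hij : i ≠ j) (hik : i ≠ k)
    (hjk : j ≠ k) (hi : z 0 i ≠ 0) (hk : z i.succ k ≠ 0) (a : Fin 4) :
    ∃ r, ∀ l, z a l = r * eval (coxTuple (Function.update 1 k (-(z i.succ j / z i.succ k)))
      (Function.update 1 i (z 0 j / z 0 i))) (coxMonomial a l) := by
  have h (l : Fin 3) : z 0 i * z l.succ i + z 0 j * z l.succ j + z 0 k * z l.succ k = 0 :=
    (sum_of_distinct hij hik hjk _).symm.trans (hz l)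
  have hpt : z 0 k = -(z 0 j * z i.succ j / z i.succ k) := by
    field_simp
    linear_combination h i - z 0 i * h0 i
  simp only [forall_iff_of_distinct hij hik hjk]
  set A := Function.update (1 : Fin 3 → ℂ) k (-(z i.succ j / z i.succ k)) with hA
  set e := Function.update (1 : Fin 3 → ℂ) i (z 0 j / z 0 i) with he
  obtain ⟨hAi, hAj, hAk⟩ : A i = 1 ∧ A j = 1 ∧ A k = -(z i.succ j / z i.succ k) := by
    simp [hA, hik, hjk]
  obtain ⟨hei, hej, hek⟩ : e i = z 0 j / z 0 i ∧ e j = 1 ∧ e k = 1 := by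
    simp [he, hij.symm, hik.symm]
  refine Fin.cases ?_ ((forall_iff_of_distinct hij hik hjk).2 ⟨?_, ?_, ?_⟩) a
  · refine ⟨z 0 i, ?_⟩
    rw [eval_coxMonomial_zero A e hij hik hjk, eval_coxMonomial_zero A e hij.symm hjk hik,
      eval_coxMonomial_zero A e hik.symm hjk.symm hij, hpt, hAi, hAj, hAk, hei, hej, hek]
    refine ⟨by ring, ?_, ?_⟩ <;> field_simp
  · obtain ⟨ε, hε, hi', hj', hk'⟩ := exists_eval_coxMonomial_succ A e hij hik hjk
    refine ⟨-ε * z i.succ k, ?_⟩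
    rw [hi', hj', hk', h0, hAj, hAk, hej, hek]
    grind
  · obtain ⟨ε, hε, hj', hi', hk'⟩ := exists_eval_coxMonomial_succ A e hij.symm hjk hik
    refine ⟨-ε * z j.succ k, ?_⟩
    rw [hi', hj', hk', h0, hAi, hAk, hei, hek]
    grind
  · obtain ⟨ε, hε, hk', hi', hj'⟩ := exists_eval_coxMonomial_succ A e hik.symm hjk.symm hij
    refine ⟨-ε * z k.succ j, ?_⟩
    rw [hi', hj', hk', h0, hAi, hAj, hei, hej]
    grind

/-- A section of `coxMap` on the open set where `coordForm p 0 i` and `coordForm p i.succ k` do not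
vanish, `j` being the third index: it normalizes to `1` the four Cox coordinates other than the one
that cuts out the line `k` and the one that cuts out the exceptional curve over `p i`. -/
def localSection (p : Fin 3 → Plane) {i k : Fin 3} (hik : i ≠ k) (j : Fin 3) (b : BlowUp p) :
    CoxSpace :=
  ⟨coxTuple (Function.update 1 k (-(coordForm p i.succ j b / coordForm p i.succ k b)))
    (Function.update 1 i (coordForm p 0 j b / coordForm p 0 i b)), by
    fin_cases i <;> fin_cases k <;> first | contradiction | simp [coxTuple]⟩

theorem exists_distinct_coordForm_ne_zero (hp : Projectivization.Independent p) (b : BlowUp p) :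
    ∃ i j k : Fin 3, i ≠ j ∧ i ≠ k ∧ j ≠ k ∧
      coordForm p 0 i b ≠ 0 ∧ coordForm p i.succ k b ≠ 0 := by
  obtain ⟨i, hi⟩ := exists_coordForm_ne_zero hp 0 b
  obtain ⟨k, hk⟩ := exists_coordForm_ne_zero hp i.succ b
  have hik : i ≠ k := by
    rintro rfl
    exact hk (coordForm_succ_self b i)
  obtain ⟨j, hj⟩ : ∃ j, j ≠ i ∧ j ≠ k := by clear hi hk; decide +revert
  exact ⟨i, j, k, hj.1.symm, hik, hj.2, hi, hk⟩

variable {i j k : Fin 3} {b : BlowUp p}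

theorem coxMap_localSection (hp : Projectivization.Independent p) (hij : i ≠ j) (hik : i ≠ k)
    (hjk : j ≠ k) (hi : coordForm p 0 i b ≠ 0) (hk : coordForm p i.succ k b ≠ 0) :
    coxMap hp (localSection p hik j b) = b := by
  refine (coxMap_eq_iff hp).2 fun a l m => ?_
  obtain ⟨r, hr⟩ := exists_smul_coxMonomial (z := fun a j => coordForm p a j b)
    (coordForm_succ_self b) (sum_coordForm_mul_coordForm b) hij hik hjk hi hk a
  rw [hr, hr]
  simp only [localSection]
  ring

theorem regularAt_localSection (hik : i ≠ k) (hi : coordForm p 0 i b ≠ 0)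
    (hk : coordForm p i.succ k b ≠ 0) (l : Fin 6) :
    RegularAt (fun b => (localSection p hik j b).1 l) b := by
  have hA := (regularAt_coordForm_div (j := j) hk).neg.update 1 k
  have he := (regularAt_coordForm_div (j := j) hi).update 1 i
  fin_cases l
  exacts [hA 0, hA 1, hA 2, he 1, he 0, he 2]

theorem exists_localSection (hp : Projectivization.Independent p) (b : BlowUp p) :
    ∃ s : BlowUp p → CoxSpace, (∀ l, RegularAt (fun b' => (s b').1 l) b) ∧
      ∀ᶠ b' in 𝓝 b, coxMap hp (s b') = b' := by
  obtain ⟨i, j, k, hij, hik, hjk, hi, hk⟩ := exists_distinct_coordForm_ne_zero hp b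
  refine ⟨localSection p hik j, regularAt_localSection hik hi hk, ?_⟩
  filter_upwards [(isOpen_nonvanishing (coordForm_mem 0 i)).mem_nhds hi,
    (isOpen_nonvanishing (coordForm_mem i.succ k)).mem_nhds hk] with b' hi' hk'
  exact coxMap_localSection hp hij hik hjk hi' hk'

theorem isQuotientMap_coxMap (hp : Projectivization.Independent p) :
    Topology.IsQuotientMap (coxMap hp) := by
  refine ⟨.of_isOpen_preimage_iff_isOpen fun U => ⟨fun hU => isOpen_iff_mem_nhds.2 fun b hb => ?_,
    fun hU => hU.preimage (continuous_coxMap hp)⟩, fun b => ?_⟩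
  · obtain ⟨s, hs, h⟩ := exists_localSection hp b
    have hsb : s b ∈ coxMap hp ⁻¹' U := by rwa [Set.mem_preimage, h.self_of_nhds]
    filter_upwards [h, continuousAt_of_regularAt hs (hU.mem_nhds hsb)] with b' hb' hU'
    exact hb' ▸ hU'
  · obtain ⟨s, -, h⟩ := exists_localSection hp b
    exact ⟨s b, h.self_of_nhds⟩

theorem regularAt_of_comp_coxMap (hp : Projectivization.Independent p) {f : BlowUp p → ℂ}
    (h : ∀ c, coxMap hp c = b → RegularAt (f ∘ coxMap hp) c) : RegularAt f b := by
  obtain ⟨s, hs, hsb⟩ := exists_localSection hp b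
  refine ((h (s b) hsb.self_of_nhds).comp_cox hs).congr (hsb.mono fun b' hb' => ?_)
  exact congrArg f hb'

end LocalSection

section Fibres

variable {p : Fin 3 → Plane} (hp : Projectivization.Independent p) {c c' : CoxSpace}

theorem coxMap_eq_coxMap_iff : coxMap hp c = coxMap hp c' ↔
    (c.1 1 * c.1 5) * (c'.1 2 * c'.1 3) = (c.1 2 * c.1 3) * (c'.1 1 * c'.1 5) ∧
    (c.1 0 * c.1 5) * (c'.1 2 * c'.1 4) = (c.1 2 * c.1 4) * (c'.1 0 * c'.1 5) ∧
    (c.1 0 * c.1 3) * (c'.1 1 * c'.1 4) = (c.1 1 * c.1 4) * (c'.1 0 * c'.1 3) := by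
  obtain ⟨κ, hκ, h⟩ := coordForm_coxMap hp c'
  have hc : coxMap hp c = coxMap hp c' ↔ ∀ a i j, eval c.1 (coxMonomial a i) *
      eval c'.1 (coxMonomial a j) = eval c.1 (coxMonomial a j) * eval c'.1 (coxMonomial a i) := by
    simp only [coxMap_eq_iff, h, mul_left_comm _ (κ _), mul_right_inj' (hκ _)]
  rw [hc]
  constructor
  · intro H
    exact ⟨by simpa [coxMonomial] using H 1 2 1, by simpa [coxMonomial] using H 2 2 0,
      by simpa [coxMonomial] using H 3 1 0⟩
  · rintro ⟨h0, h1, h2⟩ a i j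
    fin_cases a <;> fin_cases i <;> fin_cases j <;> simp [coxMonomial] <;> grind

theorem coxMap_coxShift_eq (h : coxMap hp c = coxMap hp c') :
    coxMap hp (coxShift c) = coxMap hp (coxShift c') := by
  obtain ⟨h0, h1, h2⟩ := (coxMap_eq_coxMap_iff hp).1 h
  refine (coxMap_eq_coxMap_iff hp).2 ⟨?_, ?_, ?_⟩
  · change c.1 4 * c.1 1 * (c'.1 3 * c'.1 0) = c.1 3 * c.1 0 * (c'.1 4 * c'.1 1)
    linear_combination -h2
  · change c.1 5 * c.1 1 * (c'.1 3 * c'.1 2) = c.1 3 * c.1 2 * (c'.1 5 * c'.1 1)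
    linear_combination h0
  · change c.1 5 * c.1 0 * (c'.1 4 * c'.1 2) = c.1 4 * c.1 2 * (c'.1 5 * c'.1 0)
    linear_combination h1

theorem eq_zero_of_coxMap_eq (h : coxMap hp c = coxMap hp c') {k : Fin 6} (hk : c.1 k = 0) :
    c'.1 k = 0 := by
  obtain ⟨h0, h1, h2⟩ := (coxMap_eq_coxMap_iff hp).1 h
  obtain ⟨c, hc⟩ := c
  obtain ⟨c', hc'⟩ := c'
  clear h
  fin_cases k <;> grind

theorem eq_zero_iff_of_coxMap_eq (h : coxMap hp c = coxMap hp c') (k : Fin 6) :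
    c.1 k = 0 ↔ c'.1 k = 0 :=
  ⟨eq_zero_of_coxMap_eq hp h, eq_zero_of_coxMap_eq hp h.symm⟩

/-- A choice of Cox coordinates of a point of the blow-up. -/
def coxLift (b : BlowUp p) : CoxSpace :=
  Function.surjInv (isQuotientMap_coxMap hp).surjective b

theorem coxMap_coxLift (b : BlowUp p) : coxMap hp (coxLift hp b) = b :=
  Function.surjInv_eq (isQuotientMap_coxMap hp).surjective b

/-- The open set of the blow-up where the `k`-th Cox coordinate does not vanish. -/
def coordOpen (k : Fin 6) : Opens (BlowUp p) :=
  ⟨{b | (coxLift hp b).1 k ≠ 0}, by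
    rw [← (isQuotientMap_coxMap hp).isOpen_preimage]
    convert isOpen_eval_ne_zero (X k) using 1
    ext c
    simp [eq_zero_iff_of_coxMap_eq hp (coxMap_coxLift hp (coxMap hp c)) k]⟩

theorem mem_coordOpen {k : Fin 6} : coxMap hp c ∈ coordOpen hp k ↔ c.1 k ≠ 0 :=
  not_congr (eq_zero_iff_of_coxMap_eq hp (coxMap_coxLift hp _) k)

end Fibres

/-! ### The automorphism -/

section Automorphism

/-- The action of `coxShift` on the indices of the Cox coordinates. -/
def shiftPerm : Equiv.Perm (Fin 6) where
  toFun := ![5, 4, 3, 0, 2, 1]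
  invFun := ![3, 5, 4, 2, 1, 0]
  left_inv := by decide
  right_inv := by decide

theorem coxShift_apply (c : CoxSpace) (k : Fin 6) : (coxShift c).1 k = c.1 (shiftPerm k) := by
  fin_cases k <;> rfl

theorem coxShift_iterate_apply (n : ℕ) (c : CoxSpace) (k : Fin 6) :
    (coxShift^[n] c).1 k = c.1 ((shiftPerm ^ n) k) := by
  induction n generalizing k with
  | zero => rfl
  | succ n ih =>
    rw [Function.iterate_succ_apply', coxShift_apply, ih, pow_succ, Equiv.Perm.mul_apply]

theorem coxShift_iterate_six (c : CoxSpace) : coxShift^[6] c = c :=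
  Subtype.ext <| funext fun k => by
    rw [coxShift_iterate_apply, show shiftPerm ^ 6 = 1 by decide, Equiv.Perm.one_apply]

theorem isMorphism_coxShift : IsMorphism coxShift := by
  have h (c : CoxSpace) (k : Fin 6) : RegularAt (fun c' => (coxShift c').1 k) c := by
    simpa [coxShift_apply] using regularAt_eval (X (shiftPerm k)) c
  exact isMorphism_of_regularAt
    (continuous_iff_continuousAt.2 fun c => continuousAt_of_regularAt (h c))
    fun f c hf => hf.comp_cox (h c)

variable {p : Fin 3 → Plane} (hp : Projectivization.Independent p)

/-- The map of the blow-up induced by `coxShift`. -/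
def blowUpShift (b : BlowUp p) : BlowUp p := coxMap hp (coxShift (coxLift hp b))

theorem blowUpShift_coxMap (c : CoxSpace) :
    blowUpShift hp (coxMap hp c) = coxMap hp (coxShift c) :=
  coxMap_coxShift_eq hp (coxMap_coxLift hp _)

theorem blowUpShift_comp_coxMap : blowUpShift hp ∘ coxMap hp = coxMap hp ∘ coxShift :=
  funext (blowUpShift_coxMap hp)

theorem blowUpShift_iterate_coxMap (n : ℕ) (c : CoxSpace) :
    (blowUpShift hp)^[n] (coxMap hp c) = coxMap hp (coxShift^[n] c) :=
  (Function.Semiconj.iterate_right (fun c => (blowUpShift_coxMap hp c).symm) n c).symm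

theorem blowUpShift_iterate_six (b : BlowUp p) : (blowUpShift hp)^[6] b = b := by
  obtain ⟨c, rfl⟩ := (isQuotientMap_coxMap hp).surjective b
  rw [blowUpShift_iterate_coxMap, coxShift_iterate_six]

theorem isMorphism_blowUpShift : IsMorphism (blowUpShift hp) := by
  have hcont : Continuous (blowUpShift hp) := by
    rw [(isQuotientMap_coxMap hp).continuous_iff, blowUpShift_comp_coxMap]
    exact (continuous_coxMap hp).comp isMorphism_coxShift.1
  refine isMorphism_of_regularAt hcont fun f b hf => regularAt_of_comp_coxMap hp ?_
  rintro c rfl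
  rw [blowUpShift_coxMap] at hf
  rw [Function.comp_assoc, blowUpShift_comp_coxMap]
  exact isMorphism_coxShift.regularAt_comp ((isMorphism_coxMap hp).regularAt_comp hf)

/-- The automorphism `σ` of the blow-up induced by `coxShift`. -/
def shiftAut : VAut (BlowUp p) :=
  ⟨{ toFun := blowUpShift hp
     invFun := (blowUpShift hp)^[5]
     left_inv := blowUpShift_iterate_six hp
     right_inv := fun b => by
      rw [← Function.iterate_succ_apply' (blowUpShift hp), blowUpShift_iterate_six] },
    isMorphism_blowUpShift hp, (isMorphism_blowUpShift hp).iterate 5⟩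

theorem shiftAut_coxMap (c : CoxSpace) :
    (shiftAut hp : Equiv.Perm (BlowUp p)) (coxMap hp c) = coxMap hp (coxShift c) :=
  blowUpShift_coxMap hp c

theorem shiftAut_pow_coxMap (n : ℕ) (c : CoxSpace) :
    ((shiftAut hp ^ n : VAut (BlowUp p)) : Equiv.Perm (BlowUp p)) (coxMap hp c) =
      coxMap hp (coxShift^[n] c) := by
  rw [Subgroup.coe_pow, Equiv.Perm.coe_pow]
  exact blowUpShift_iterate_coxMap hp n c

/-- The point of `ℂ⁶ ∖ W` with `k`-th coordinate `0` and all others `1`. -/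
def coordPoint (k : Fin 6) : CoxSpace :=
  ⟨Function.update 1 k 0, by fin_cases k <;> simp⟩

theorem shiftAut_pow_ne_one {n : ℕ} (hn : (shiftPerm ^ n) 0 ≠ 0) : shiftAut hp ^ n ≠ 1 := by
  intro h
  have h1 : coxMap hp (coordPoint 0) = coxMap hp (coxShift^[n] (coordPoint 0)) := by
    simpa [h] using shiftAut_pow_coxMap hp n (coordPoint 0)
  have h2 := (eq_zero_iff_of_coxMap_eq hp h1 0).1 (by simp [coordPoint])
  rw [coxShift_iterate_apply] at h2
  simp [coordPoint, hn] at h2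

theorem orderOf_shiftAut : orderOf (shiftAut hp) = 6 := by
  have hperm : ∀ m < 6, 0 < m → (shiftPerm ^ m) 0 ≠ 0 := by decide
  refine (orderOf_eq_iff (by norm_num)).2
    ⟨Subtype.ext (Equiv.ext fun b => ?_), fun m hm hm0 => shiftAut_pow_ne_one hp (hperm m hm hm0)⟩
  obtain ⟨c, rfl⟩ := (isQuotientMap_coxMap hp).surjective b
  rw [shiftAut_pow_coxMap, coxShift_iterate_six]
  rfl

end Automorphism

/-! ### Nonvanishing loci and divisibility -/

theorem RegularAt.eq_of_frequently_eq {X : Type} [TopologicalSpace X] [Variety X]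
    [IsLocallyRinged X] {f g : X → ℂ} {x : X} (hf : RegularAt f x) (hg : RegularAt g x)
    (h : ∃ᶠ y in 𝓝 x, f y = g y) : f x = g x := by
  by_contra hne
  have hsub : RegularAt (fun y => f y + -g y) x := hf.add hg.neg
  refine h ((hsub.eventually_ne_zero ?_).mono fun y hy hyfg => hy ?_)
  · rwa [← sub_eq_add_neg, sub_ne_zero]
  · rw [hyfg, add_neg_cancel]

theorem RegularAt.eventually_regularAt {X : Type} [TopologicalSpace X] [Variety X] {f : X → ℂ}
    {x : X} (hf : RegularAt f x) : ∀ᶠ y in 𝓝 x, RegularAt f y := by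
  obtain ⟨U, hx, hU⟩ := hf
  filter_upwards [U.2.mem_nhds hx] with y hy using ⟨U, hy, hU⟩

/-- A function that is locally a multiple of `s` with regular quotient is so globally, since the
local quotients agree on the dense set where `s` does not vanish. -/
theorem existsUnique_regular_quotient {X : Type} [TopologicalSpace X] [Variety X]
    [IsLocallyRinged X] {V : Opens X} {f s : X → ℂ} (hs : ∀ x ∈ V, ∃ᶠ y in 𝓝 x, s y ≠ 0)
    (h : ∀ x ∈ V, ∃ q, RegularAt q x ∧ ∀ᶠ y in 𝓝 x, f y = q y * s y) :
    ∃! q : V → ℂ, q ∈ Variety.reg V ∧ ∀ x : V, f x = q x * s x := by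
  have unique {x : X} (hx : x ∈ V) {q q' : X → ℂ} (hq : RegularAt q x) (hq' : RegularAt q' x)
      (hfq : ∀ᶠ y in 𝓝 x, f y = q y * s y) (hfq' : ∀ᶠ y in 𝓝 x, f y = q' y * s y) : q x = q' x :=
    hq.eq_of_frequently_eq hq' <| ((hs x hx).and_eventually (hfq.and hfq')).mono
      fun y ⟨hy, hqy, hqy'⟩ => mul_right_cancel₀ hy (hqy.symm.trans hqy')
  choose! q hq hfq using h
  have hV {x : X} (hx : x ∈ V) : ∀ᶠ y in 𝓝 x, y ∈ V := V.2.mem_nhds hx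
  have agree : ∀ x ∈ V, q x =ᶠ[𝓝 x] fun y => q y y := fun x hx => by
    filter_upwards [hV hx, (hq x hx).eventually_regularAt, (hfq x hx).eventually_nhds]
      with y hy hqy hfqy using unique hy hqy (hq y hy) hfqy (hfq y hy)
  have hreg : ∀ x ∈ V, RegularAt (fun y => q y y) x := fun x hx => (hq x hx).congr (agree x hx)
  have hf : ∀ x ∈ V, f x = q x x * s x := fun x hx => (hfq x hx).self_of_nhds
  refine ⟨fun x => q x x, ⟨mem_reg_of_regularAt (fun _ => rfl) hreg, fun x => hf x x.2⟩, ?_⟩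
  rintro r ⟨hr, hfr⟩
  obtain ⟨r', hr'⟩ := exists_extension r
  funext ⟨x, hx⟩
  rw [hr']
  have hfr' : ∀ᶠ y in 𝓝 x, f y = r' y * s y := by
    filter_upwards [hV hx] with y hy using (hfr ⟨y, hy⟩).trans (by rw [hr'])
  exact unique (q' := fun y => q y y) hx (regularAt_of_mem_reg hr hr' hx) (hreg x hx) hfr'
    ((hV hx).mono hf)

section Density

variable {k : Fin 6} {F : MvPolynomial (Fin 6) ℂ}

theorem exists_coxSpace {c : Fin 6 → ℂ} (h : ∀ j ≠ k, c j ≠ 0) : ∃ c' : CoxSpace, c'.1 = c := by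
  have h' : ∀ i j, i ≠ j → ¬(c i = 0 ∧ c j = 0) := by
    rintro i j hij ⟨hi, hj⟩
    obtain rfl | hik := eq_or_ne i k
    · exact h j hij.symm hj
    · exact h i hik hi
  refine ⟨⟨c, ?_, ?_, ?_, ?_, ?_, ?_, ?_, ?_, ?_⟩, rfl⟩ <;> exact h' _ _ (by decide)

theorem exists_eval_ne_zero (hF : F ≠ 0) : ∃ c : CoxSpace, (∀ j, c.1 j ≠ 0) ∧ eval c.1 F ≠ 0 := by
  have hne : F * ∏ j, X j ≠ 0 := mul_ne_zero hF (Finset.prod_ne_zero_iff.2 fun j _ => X_ne_zero j)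
  contrapose! hne
  refine MvPolynomial.funext fun c => ?_
  simp only [map_mul, map_prod, eval_X, map_zero, mul_eq_zero, Finset.prod_eq_zero_iff,
    Finset.mem_univ, true_and]
  by_cases hc : ∀ j, c j ≠ 0
  · obtain ⟨c, rfl⟩ := exists_coxSpace (k := 0) fun j _ => hc j
    exact .inl (hne c hc)
  · exact .inr (by simpa using hc)

theorem frequently_forall_ne_zero (c : CoxSpace) : ∃ᶠ c' in 𝓝 c, ∀ j, c'.1 j ≠ 0 := by
  intro h
  obtain ⟨G, hG, hGc⟩ := mem_nhds_cox_iff.1 h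
  obtain ⟨c', hc', hGc'⟩ := exists_eval_ne_zero (F := G) (by rintro rfl; exact hG (map_zero _))
  exact hGc c' hGc' hc'

theorem eq_zero_of_eventually_eval_eq_zero {c : CoxSpace}
    (h : ∀ᶠ c' in 𝓝 c, eval c'.1 F = 0) : F = 0 := by
  obtain ⟨G, hG, hGc⟩ := mem_nhds_cox_iff.1 h
  by_contra hF
  obtain ⟨c', -, hFG⟩ := exists_eval_ne_zero
    (mul_ne_zero hF (by rintro rfl; exact hG (map_zero _) : G ≠ 0))
  rw [map_mul] at hFG
  exact left_ne_zero_of_mul hFG (hGc c' (right_ne_zero_of_mul hFG))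

variable (k) in
/-- The restriction of a polynomial to the hyperplane where the `k`-th coordinate vanishes,
extended to a polynomial that does not involve this coordinate. -/
def restrictZero : MvPolynomial (Fin 6) ℂ →ₐ[ℂ] MvPolynomial (Fin 6) ℂ :=
  bind₁ (Function.update X k 0)

theorem eval_restrictZero (F : MvPolynomial (Fin 6) ℂ) (c : Fin 6 → ℂ) :
    eval c (restrictZero k F) = eval (Function.update c k 0) F := by
  rw [restrictZero, eval, eval₂Hom_bind₁]
  congr 2
  ext j
  obtain rfl | hj := eq_or_ne j k
  · simp
  · simp [hj]

theorem restrictZero_ne_zero {c : Fin 6 → ℂ} (hc : c k = 0) (hF : eval c F ≠ 0) :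
    restrictZero k F ≠ 0 := by
  intro h
  rw [← Function.update_eq_self k c, hc, ← eval_restrictZero, h, map_zero] at hF
  exact hF rfl

theorem X_dvd_sub_restrictZero (k : Fin 6) (F : MvPolynomial (Fin 6) ℂ) :
    X k ∣ F - restrictZero k F := by
  rw [← Ideal.mem_span_singleton, ← Ideal.Quotient.eq]
  refine DFunLike.congr_fun (g := (Ideal.Quotient.mkₐ ℂ (Ideal.span {X k})).comp (restrictZero k))
    (algHom_ext fun j => ?_ : Ideal.Quotient.mkₐ ℂ (Ideal.span {X k}) = _) F
  obtain rfl | hj := eq_or_ne j k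
  · simp [restrictZero]
  · simp [restrictZero, hj]

theorem exists_restrictZero_ne_zero (hF : restrictZero k F ≠ 0) :
    ∃ c : CoxSpace, (c.1 k = 0 ∧ ∀ j ≠ k, c.1 j ≠ 0) ∧ eval c.1 F ≠ 0 := by
  obtain ⟨c, hc, hFc⟩ := exists_eval_ne_zero hF
  rw [eval_restrictZero] at hFc
  have h : ∀ j ≠ k, Function.update c.1 k 0 j ≠ 0 := fun j hj => by
    rw [Function.update_of_ne hj]
    exact hc j
  obtain ⟨c', hc'⟩ := exists_coxSpace h
  rw [← hc'] at h hFc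
  exact ⟨c', ⟨by rw [hc', Function.update_self], h⟩, hFc⟩

theorem frequently_eq_zero_and_ne_zero {c : CoxSpace} (hc : c.1 k = 0) :
    ∃ᶠ c' in 𝓝 c, c'.1 k = 0 ∧ ∀ j ≠ k, c'.1 j ≠ 0 := by
  intro h
  obtain ⟨G, hG, hGc⟩ := mem_nhds_cox_iff.1 h
  obtain ⟨c', hc', hGc'⟩ := exists_restrictZero_ne_zero (restrictZero_ne_zero hc hG)
  exact hGc c' hGc' hc'

theorem X_dvd_of_eventually_eval_eq_zero {c : CoxSpace} (hc : c.1 k = 0)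
    (h : ∀ᶠ c' in 𝓝 c, c'.1 k = 0 → eval c'.1 F = 0) : X k ∣ F := by
  suffices restrictZero k F = 0 by simpa [this] using X_dvd_sub_restrictZero k F
  obtain ⟨G, hG, hGc⟩ := mem_nhds_cox_iff.1 h
  by_contra hF
  obtain ⟨c', hc', hFG⟩ := exists_restrictZero_ne_zero (k := k) (F := F * G) <| by
    rw [map_mul]
    exact mul_ne_zero hF (restrictZero_ne_zero hc hG)
  rw [map_mul] at hFG
  exact left_ne_zero_of_mul hFG (hGc c' (right_ne_zero_of_mul hFG) hc'.1)

theorem RegularAt.exists_eq_mul_coord {φ : CoxSpace → ℂ} {c : CoxSpace} (hφ : RegularAt φ c)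
    (h : ∀ᶠ c' in 𝓝 c, c'.1 k = 0 → φ c' = 0) :
    ∃ ψ, RegularAt ψ c ∧ ∀ᶠ c' in 𝓝 c, φ c' = ψ c' * c'.1 k := by
  have hX : RegularAt (fun c' => c'.1 k) c := by simpa using regularAt_eval (X k) c
  by_cases hc : c.1 k = 0
  · obtain ⟨F, G, hG, hFG⟩ := regularAt_cox_iff.1 hφ
    have hG' := (isOpen_eval_ne_zero G).mem_nhds hG
    obtain ⟨F', rfl⟩ : X k ∣ F := X_dvd_of_eventually_eval_eq_zero hc <| by
      filter_upwards [h, hFG, hG'] with c' hc' hφc' hGc' hk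
      exact (div_eq_zero_iff.1 (hφc'.symm.trans (hc' hk))).resolve_right hGc'
    refine ⟨_, (regularAt_eval F' c).div (regularAt_eval G c) hG, hFG.mono fun c' hc' => ?_⟩
    rw [hc', map_mul, eval_X, mul_div_assoc, mul_comm]
  · exact ⟨_, hφ.div hX hc, (hX.eventually_ne_zero hc).mono fun c' hc' =>
      (div_mul_cancel₀ _ hc').symm⟩

end Density

/-! ### The hexagon of `(-1)`-curves -/

section Hexagon

variable {p : Fin 3 → Plane} (hp : Projectivization.Independent p)

theorem coordForm_zero_eq_zero_iff {i : Fin 3} {c : CoxSpace} :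
    coordForm p 0 i (coxMap hp c) = 0 ↔ eval c.1 (coxMonomial 0 i) = 0 := by
  obtain ⟨κ, hκ, h⟩ := coordForm_coxMap hp c
  rw [h, mul_eq_zero, or_iff_right (hκ 0)]

theorem adjugate_frame_mulVec_frame (i j : Fin 3) :
    ((frame p)ᵀ.adjugate *ᵥ (p j).rep) i = if i = j then (frame p).det else 0 := by
  have h : (p j).rep = (frame p)ᵀ *ᵥ Pi.single j 1 := by simp [frame]
  rw [h, mulVec_mulVec, adjugate_mul, det_transpose, smul_mulVec, one_mulVec, Pi.smul_apply,
    Pi.single_apply, smul_ite, smul_zero, smul_eq_mul, mul_one]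

theorem mem_iSup_submodule_iff (hp : Projectivization.Independent p) (w : Fin 3 → ℂ) (i : Fin 3) :
    w ∈ ⨆ j ∈ ({i}ᶜ : Set (Fin 3)), (p j).submodule ↔ ((frame p)ᵀ.adjugate *ᵥ w) i = 0 := by
  constructor
  · intro h
    suffices (⨆ j ∈ ({i}ᶜ : Set (Fin 3)), (p j).submodule) ≤
        LinearMap.ker (LinearMap.proj i ∘ₗ (frame p)ᵀ.adjugate.mulVecLin) from this h
    refine iSup₂_le fun j hj => ?_
    rw [Projectivization.submodule_eq, Submodule.span_singleton_le_iff_mem, LinearMap.mem_ker]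
    exact (adjugate_frame_mulVec_frame i j).trans (if_neg (Ne.symm hj))
  · intro h
    have key : (frame p).det • w = ∑ j, ((frame p)ᵀ.adjugate *ᵥ w) j • (p j).rep :=
      calc (frame p).det • w = (frame p)ᵀ *ᵥ ((frame p)ᵀ.adjugate *ᵥ w) := by
            rw [mulVec_mulVec, mul_adjugate, det_transpose, smul_mulVec, one_mulVec]
        _ = _ := by
            rw [mulVec_transpose, vecMul_eq_sum]
            rfl
    rw [← Submodule.smul_mem_iff _ (det_frame_ne_zero hp), key]
    refine sum_mem fun j _ => ?_
    obtain rfl | hj := eq_or_ne j i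
    · simp [h]
    · refine Submodule.smul_mem _ _ (Submodule.mem_iSup_of_mem j (Submodule.mem_iSup_of_mem hj ?_))
      rw [Projectivization.submodule_eq]
      exact Submodule.mem_span_singleton_self _

theorem eq_iff_forall_coordForm (hp : Projectivization.Independent p) {b : BlowUp p} {i : Fin 3} :
    b.1 0 = p i ↔ ∀ j ≠ i, coordForm p 0 j b = 0 := by
  constructor
  · intro h j hj
    simp only [coordForm, h]
    exact (adjugate_frame_mulVec_frame j i).trans (if_neg hj)
  · intro h
    rw [← (b.1 0).mk_rep, ← (p i).mk_rep]
    refine mk_eq_mk_of_mulVec (det_coordMatrix_ne_zero hp 0) _ _ fun l m => ?_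
    change coordForm p 0 l b * ((frame p)ᵀ.adjugate *ᵥ _) m =
      coordForm p 0 m b * ((frame p)ᵀ.adjugate *ᵥ _) l
    simp only [adjugate_frame_mulVec_frame]
    grind

theorem coxMap_mem_exceptionalCurve (i : Fin 3) (c : CoxSpace) :
    coxMap hp c ∈ exceptionalCurve p i ↔ c.1 (![4, 3, 5] i) = 0 := by
  have h : coxMap hp c ∈ exceptionalCurve p i ↔ ∀ j ≠ i, eval c.1 (coxMonomial 0 j) = 0 := by
    simp only [← coordForm_zero_eq_zero_iff hp]
    exact eq_iff_forall_coordForm hp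
  obtain ⟨c, hc⟩ := c
  rw [h]
  fin_cases i <;> simp [coxMonomial, Fin.forall_fin_succ] <;> grind

theorem coxMap_mem_line (i : Fin 3) (c : CoxSpace) :
    (((coxMap hp c).1 0).submodule ≤ ⨆ j ∈ ({i}ᶜ : Set (Fin 3)), (p j).submodule) ∧
      (∀ j, (coxMap hp c).1 0 ≠ p j) ↔
      c.1 (![0, 1, 2] i) = 0 ∧ ∀ j, c.1 (![4, 3, 5] j) ≠ 0 := by
  rw [Projectivization.submodule_eq, Submodule.span_singleton_le_iff_mem,
    mem_iSup_submodule_iff hp]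
  refine (and_congr (coordForm_zero_eq_zero_iff hp (i := i))
    (forall_congr' fun j => not_congr (coxMap_mem_exceptionalCurve hp j c))).trans
    (and_congr_left fun h => ?_)
  have h' := h 0
  have h'' := h 1
  have h''' := h 2
  fin_cases i <;> simp_all [coxMonomial]

theorem coxMap_mem_lineCurve (i : Fin 3) (c : CoxSpace) :
    coxMap hp c ∈ lineCurve p i ↔ c.1 (![0, 1, 2] i) = 0 := by
  constructor
  · intro h
    by_contra hc
    obtain ⟨b, hb, hb'⟩ := mem_closure_iff.1 h _ (coordOpen hp _).2 ((mem_coordOpen hp).2 hc)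
    obtain ⟨c', rfl⟩ := (isQuotientMap_coxMap hp).surjective b
    exact (mem_coordOpen hp).1 hb ((coxMap_mem_line hp i c').1 hb').1
  · intro hc
    refine mem_closure_iff_frequently.2 (((continuous_coxMap hp).tendsto c).frequently ?_)
    refine (frequently_eq_zero_and_ne_zero hc).mono fun c' hc' =>
      (coxMap_mem_line hp i c').2 ⟨hc'.1, fun j => hc'.2 _ ?_⟩
    clear * -
    decide +revert

theorem coxMap_mem_hexagon (k : Fin 6) (c : CoxSpace) :
    coxMap hp c ∈ hexagon p k ↔ c.1 (![0, 5, 1, 4, 2, 3] k) = 0 := by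
  fin_cases k
  exacts [coxMap_mem_lineCurve hp 0 c, coxMap_mem_exceptionalCurve hp 2 c,
    coxMap_mem_lineCurve hp 1 c, coxMap_mem_exceptionalCurve hp 0 c,
    coxMap_mem_lineCurve hp 2 c, coxMap_mem_exceptionalCurve hp 1 c]

theorem shiftAut_preimage_hexagon (k : Fin 6) :
    (shiftAut hp : Equiv.Perm (BlowUp p)) ⁻¹' hexagon p k = hexagon p (k + 1) := by
  ext b
  obtain ⟨c, rfl⟩ := (isQuotientMap_coxMap hp).surjective b
  rw [Set.mem_preimage, shiftAut_coxMap, coxMap_mem_hexagon, coxMap_mem_hexagon, coxShift_apply]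
  fin_cases k <;> rfl

end Hexagon

/-! ### The line bundle -/

section Frames

/-- The local frames `X`, `Zt / u`, `Yt / s` of the pull-back of the line bundle. Since `a / 0 = 0`,
a frame is nonzero exactly where none of the coordinates occurring in it vanishes. -/
def coxFrame (i : Fin 3) (c : CoxSpace) : ℂ :=
  ![c.1 0, c.1 2 * c.1 4 / c.1 5, c.1 1 * c.1 4 / c.1 3] i

theorem regularAt_coord (k : Fin 6) (c : CoxSpace) : RegularAt (fun c' => c'.1 k) c := by
  simpa using regularAt_eval (X k) c

theorem regularAt_coxFrame {i : Fin 3} {c : CoxSpace} (h : coxFrame i c ≠ 0) :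
    RegularAt (coxFrame i) c := by
  fin_cases i
  · exact regularAt_coord 0 c
  · exact ((regularAt_coord 2 c).mul (regularAt_coord 4 c)).div (regularAt_coord 5 c)
      (div_ne_zero_iff.1 h).2
  · exact ((regularAt_coord 1 c).mul (regularAt_coord 4 c)).div (regularAt_coord 3 c)
      (div_ne_zero_iff.1 h).2

theorem exists_coxFrame_ne_zero (c : CoxSpace) : ∃ i, coxFrame i c ≠ 0 := by
  obtain ⟨c, hc⟩ := c
  simp only [coxFrame, Fin.exists_fin_succ, Fin.succ_zero_eq_one, Fin.succ_one_eq_two, cons_val,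
    div_ne_zero_iff, mul_ne_zero_iff]
  grind

variable {p : Fin 3 → Plane} (hp : Projectivization.Independent p) {c c' : CoxSpace} {i j : Fin 3}

theorem coxFrame_mul_coxFrame (h : coxMap hp c = coxMap hp c') (i j : Fin 3) :
    coxFrame i c * coxFrame j c' = coxFrame j c * coxFrame i c' := by
  obtain ⟨h0, h1, h2⟩ := (coxMap_eq_coxMap_iff hp).1 h
  have h3 := eq_zero_iff_of_coxMap_eq hp h 3
  have h5 := eq_zero_iff_of_coxMap_eq hp h 5
  fin_cases i <;> fin_cases j <;> simp [coxFrame] <;> grind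

theorem coxFrame_eq_zero_iff_of_coxMap_eq (h : coxMap hp c = coxMap hp c') (i : Fin 3) :
    coxFrame i c = 0 ↔ coxFrame i c' = 0 := by
  have hzero := eq_zero_iff_of_coxMap_eq hp h
  fin_cases i <;> simp [coxFrame, hzero]

/-- The quotient of two local frames of the pull-back of the line bundle is a rational function on
the blow-up. -/
def frameRatio (i j : Fin 3) (b : BlowUp p) : ℂ :=
  coxFrame j (coxLift hp b) / coxFrame i (coxLift hp b)

theorem frameRatio_coxMap (i j : Fin 3) (c : CoxSpace) :
    frameRatio hp i j (coxMap hp c) = coxFrame j c / coxFrame i c := by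
  have h := coxMap_coxLift hp (coxMap hp c)
  have hi := coxFrame_eq_zero_iff_of_coxMap_eq hp h i
  by_cases h0 : coxFrame i c = 0
  · rw [frameRatio, h0, hi.2 h0, div_zero, div_zero]
  · rw [frameRatio, div_eq_div_iff (hi.not.2 h0) h0]
    rw [coxFrame_mul_coxFrame hp h j i, mul_comm]

theorem coxFrame_eq_frameRatio_mul (j : Fin 3) (hi : coxFrame i c ≠ 0) :
    coxFrame j c = frameRatio hp i j (coxMap hp c) * coxFrame i c := by
  rw [frameRatio_coxMap, div_mul_cancel₀ _ hi]

/-- The open set of the blow-up over which the `i`-th frame does not vanish. -/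
def bundleOpen (i : Fin 3) : Opens (BlowUp p) :=
  ⟨{b | coxFrame i (coxLift hp b) ≠ 0}, by
    rw [← (isQuotientMap_coxMap hp).isOpen_preimage, isOpen_iff_eventually]
    intro c hc
    have h (c : CoxSpace) :=
      not_congr (coxFrame_eq_zero_iff_of_coxMap_eq hp (coxMap_coxLift hp (coxMap hp c)) i)
    have hc' := (h c).1 hc
    exact ((regularAt_coxFrame hc').eventually_ne_zero hc').mono fun c' => (h c').2⟩

theorem mem_bundleOpen : coxMap hp c ∈ bundleOpen hp i ↔ coxFrame i c ≠ 0 :=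
  not_congr (coxFrame_eq_zero_iff_of_coxMap_eq hp (coxMap_coxLift hp _) i)

theorem regularAt_frameRatio {b : BlowUp p} (hi : b ∈ bundleOpen hp i)
    (hj : ∀ c, coxMap hp c = b → RegularAt (coxFrame j) c) : RegularAt (frameRatio hp i j) b := by
  refine regularAt_of_comp_coxMap hp fun c hc => ?_
  rw [← hc, mem_bundleOpen] at hi
  exact ((hj c hc).div (regularAt_coxFrame hi) hi).congr
    (.of_forall fun c' => (frameRatio_coxMap hp i j c').symm)

theorem frameRatio_mul_frameRatio (i : Fin 3) {k : Fin 3} {b : BlowUp p}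
    (hj : b ∈ bundleOpen hp j) :
    frameRatio hp i j b * frameRatio hp j k b = frameRatio hp i k b := by
  rw [mul_comm]
  exact div_mul_div_cancel₀ hj

end Frames

section LineBundle

variable {p : Fin 3 → Plane} (hp : Projectivization.Independent p)

/-- The line bundle `𝒪(L₁)`. -/
def coxBundle : LineBundle (BlowUp p) where
  ι := Fin 3
  U := bundleOpen hp
  cover _ := exists_coxFrame_ne_zero _
  g i j b := frameRatio hp i j b
  g_reg _ _ := mem_reg_of_regularAt (fun _ => rfl) fun _ hb =>
    regularAt_frameRatio hp (Opens.mem_inf.1 hb).1 fun _ hc =>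
      regularAt_coxFrame ((mem_bundleOpen hp).1 (hc ▸ (Opens.mem_inf.1 hb).2))
  g_self _ b := div_self (Opens.mem_inf.1 b.2).1
  g_mul i _ _ _ _ hj _ := frameRatio_mul_frameRatio hp i hj

/-- The trivialization of the pull-back of `coxBundle` to `ℂ⁶ ∖ W` given by the frames. -/
def coxTrivialization : CoxTrivialization hp (coxBundle hp) where
  e := coxFrame
  regular i c hc := by
    obtain ⟨O, hcO, hO⟩ := regularAt_coxFrame ((mem_bundleOpen hp).1 hc)
    exact ⟨O ⊓ Opens.comap ⟨coxMap hp, continuous_coxMap hp⟩ (bundleOpen hp i), ⟨hcO, hc⟩,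
      fun c' hc' => hc'.2, Variety.res inf_le_left hO⟩
  ne_zero _ _ hc := (mem_bundleOpen hp).1 hc
  compat _ j _ hi _ := coxFrame_eq_frameRatio_mul hp j ((mem_bundleOpen hp).1 hi)

/-- The section of `coxBundle` with pull-back `X`. -/
def divisorSection : H0 (coxBundle hp) :=
  ⟨fun i b => frameRatio hp i 0 b,
    fun _ => mem_reg_of_regularAt (fun _ => rfl) fun _ hb =>
      regularAt_frameRatio hp hb fun c _ => regularAt_coord 0 c,
    fun i _ _ _ hj => (frameRatio_mul_frameRatio hp i hj).symm⟩

theorem frequently_frameRatio_ne_zero (i j : Fin 3) (b : BlowUp p) :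
    ∃ᶠ b' in 𝓝 b, frameRatio hp i j b' ≠ 0 := by
  obtain ⟨c, rfl⟩ := (isQuotientMap_coxMap hp).surjective b
  refine ((continuous_coxMap hp).tendsto c).frequently
    ((frequently_forall_ne_zero c).mono fun c' hc' => ?_)
  have h (i : Fin 3) : coxFrame i c' ≠ 0 := by fin_cases i <;> simp [coxFrame, hc']
  rw [frameRatio_coxMap]
  exact div_ne_zero (h j) (h i)

theorem exists_regularAt_eq_mul_frameRatio {i : Fin 3} {b : BlowUp p} (hb : b ∈ bundleOpen hp i)
    {f : BlowUp p → ℂ} (hf : RegularAt f b) (h0 : ∀ᶠ b' in 𝓝 b, b' ∈ lineCurve p 0 → f b' = 0) :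
    ∃ q, RegularAt q b ∧ ∀ᶠ b' in 𝓝 b, f b' = q b' * frameRatio hp i 0 b' := by
  obtain ⟨s, hs, hsb⟩ := exists_localSection hp b
  have hb' := hsb.self_of_nhds
  have hf' : RegularAt (fun c => f (coxMap hp c)) (s b) :=
    (isMorphism_coxMap hp).regularAt_comp (hb'.symm ▸ hf)
  obtain ⟨ψ, hψ, hfψ⟩ := hf'.exists_eq_mul_coord (k := 0) <| by
    filter_upwards [(continuous_coxMap hp).continuousAt.eventually (hb'.symm ▸ h0)] with c hc hc0
    exact hc ((coxMap_mem_lineCurve hp 0 c).2 hc0)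
  have hi : coxFrame i (s b) ≠ 0 := (mem_bundleOpen hp).1 (hb'.symm ▸ hb)
  refine ⟨_, (hψ.mul (regularAt_coxFrame hi)).comp_cox hs, ?_⟩
  filter_upwards [hsb, continuousAt_of_regularAt hs hfψ, (bundleOpen hp i).2.mem_nhds hb]
    with b' hsb' hfb' hb'i
  have hbi : coxFrame i (s b') ≠ 0 := (mem_bundleOpen hp).1 (hsb'.symm ▸ hb'i)
  calc f b' = f (coxMap hp (s b')) := by rw [hsb']
    _ = ψ (s b') * (s b').1 0 := hfb'
    _ = ψ (s b') * coxFrame i (s b') * frameRatio hp i 0 (coxMap hp (s b')) := by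
      rw [frameRatio_coxMap, mul_assoc, mul_div_cancel₀ _ hbi]
      rfl
    _ = _ := by rw [hsb']; rfl

theorem isOfDivisor_coxBundle : (coxBundle hp).IsOfDivisor (lineCurve p 0) := by
  refine ⟨divisorSection hp, fun i V hV => ⟨?_, fun f hf h0 => ?_⟩⟩
  · rintro ⟨b, hb⟩ hC
    obtain ⟨c, rfl⟩ := (isQuotientMap_coxMap hp).surjective b
    have hc : coxFrame 0 c = 0 := (coxMap_mem_lineCurve hp 0 c).1 hC
    exact (frameRatio_coxMap hp i 0 c).trans (by rw [hc, zero_div])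
  · obtain ⟨g, hg⟩ := exists_extension f
    simp only [hg]
    refine existsUnique_regular_quotient (fun b _ => frequently_frameRatio_ne_zero hp i 0 b)
      fun b hb => exists_regularAt_eq_mul_frameRatio hp (hV hb) (regularAt_of_mem_reg hf hg hb) ?_
    filter_upwards [V.2.mem_nhds hb] with b' hb' hC
    exact (hg ⟨b', hb'⟩).symm.trans (h0 ⟨b', hb'⟩ hC)

end LineBundle

/-! ### Sections of `ℒ_n` as polynomials -/

section RegularFunctions

variable {F G : MvPolynomial (Fin 6) ℂ}

theorem ext_of_eval_coxSpace (h : ∀ c : CoxSpace, eval c.1 F = eval c.1 G) : F = G := by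
  rw [← sub_eq_zero]
  exact eq_zero_of_eventually_eval_eq_zero (c := (exists_eval_ne_zero one_ne_zero).choose)
    (.of_forall fun c => by rw [map_sub, h c, sub_self])

theorem exists_and_of_eventually {P Q : CoxSpace → Prop} {c c' : CoxSpace}
    (hP : ∀ᶠ z in 𝓝 c, P z) (hQ : ∀ᶠ z in 𝓝 c', Q z) : ∃ z, P z ∧ Q z := by
  obtain ⟨F, hF, hFP⟩ := mem_nhds_cox_iff.1 hP
  obtain ⟨G, hG, hGQ⟩ := mem_nhds_cox_iff.1 hQ
  obtain ⟨z, -, hz⟩ := exists_eval_ne_zero <| mul_ne_zero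
    (by rintro rfl; exact hF (map_zero _) : F ≠ 0) (by rintro rfl; exact hG (map_zero _) : G ≠ 0)
  rw [map_mul] at hz
  exact ⟨z, hFP z (left_ne_zero_of_mul hz), hGQ z (right_ne_zero_of_mul hz)⟩

/-- The zeros of an irreducible factor of `G` lie on the coordinate hyperplanes, so by the
Nullstellensatz that factor is a coordinate; but every coordinate vanishes somewhere on
`CoxSpace`. -/
theorem isUnit_of_forall_eval_ne_zero (hG : ∀ c : CoxSpace, eval c.1 G ≠ 0) : IsUnit G := by
  by_contra hunit
  obtain ⟨c₀, -⟩ := exists_eval_ne_zero one_ne_zero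
  have hG0 : G ≠ 0 := by rintro rfl; exact hG c₀ (map_zero _)
  obtain ⟨π, hπ, hπG⟩ := WfDvdMonoid.exists_irreducible_factor hunit hG0
  have hπc (c : CoxSpace) : eval c.1 π ≠ 0 := ne_zero_of_dvd_ne_zero (hG c) (map_dvd _ hπG)
  have hvanish : ∏ j, X j ∈ vanishingIdeal ℂ (zeroLocus ℂ (Ideal.span {π})) := fun x hx => by
    by_contra hne
    simp only [map_prod, aeval_X, Finset.prod_ne_zero_iff, Finset.mem_univ, forall_const] at hne
    obtain ⟨c, rfl⟩ := exists_coxSpace (k := 0) fun j _ => hne j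
    exact hπc c (hx π (Ideal.mem_span_singleton_self π))
  have := (Ideal.span_singleton_prime hπ.ne_zero).2 hπ.prime
  rw [IsPrime.vanishingIdeal_zeroLocus, Ideal.mem_span_singleton] at hvanish
  obtain ⟨j, -, hj⟩ := hπ.prime.exists_mem_finset_dvd hvanish
  have hjπ : X j ∣ π := hπ.dvd_symm X_prime.irreducible hj
  obtain ⟨c, hc⟩ := exists_coxSpace (k := j) (c := Function.update 1 j 0) fun k hk => by simp [hk]
  refine ne_zero_of_dvd_ne_zero (hπc c) (map_dvd (eval c.1) hjπ) ?_
  rw [eval_X, hc, Function.update_self]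

theorem exists_polynomial_of_regularAt {φ : CoxSpace → ℂ} (hφ : ∀ c, RegularAt φ c) :
    ∃ F, ∀ c, φ c = eval c.1 F := by
  obtain ⟨c₀, -⟩ := exists_eval_ne_zero one_ne_zero
  obtain ⟨F₀, G₀, hG₀, h₀⟩ := regularAt_cox_iff.1 (hφ c₀)
  have ne {P : MvPolynomial (Fin 6) ℂ} {c : CoxSpace} (hP : eval c.1 P ≠ 0) : P ≠ 0 := by
    rintro rfl
    exact hP (map_zero _)
  obtain ⟨F, G, D, hrel, rfl, rfl⟩ :=
    UniqueFactorizationMonoid.exists_reduced_factors' F₀ G₀ (ne hG₀)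
  have hnear := (h₀.and ((isOpen_eval_ne_zero _).mem_nhds hG₀)).eventually_nhds
  have hfrac (c : CoxSpace) : eval c.1 G ≠ 0 ∧ φ c = eval c.1 F / eval c.1 G := by
    obtain ⟨F₁, G₁, hG₁, h₁⟩ := regularAt_cox_iff.1 (hφ c)
    obtain ⟨z, hz, hz₁⟩ := exists_and_of_eventually hnear
      (h₁.and ((isOpen_eval_ne_zero _).mem_nhds hG₁)).eventually_nhds
    have hcross : F * G₁ = F₁ * G := by
      rw [← sub_eq_zero]
      refine eq_zero_of_eventually_eval_eq_zero (c := z) ?_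
      filter_upwards [hz, hz₁] with z' ⟨hφ₀, (hDG : _ ≠ _)⟩ ⟨hφ₁, (hG₁ : _ ≠ _)⟩
      rw [map_mul] at hDG
      rw [hφ₀, map_mul, map_mul, mul_div_mul_left _ _ (left_ne_zero_of_mul hDG),
        div_eq_div_iff (right_ne_zero_of_mul hDG) hG₁] at hφ₁
      rw [map_sub, map_mul, map_mul, hφ₁, sub_self]
    obtain ⟨E, rfl⟩ : G ∣ G₁ := hrel.symm.dvd_of_dvd_mul_left ⟨F₁, by rw [hcross, mul_comm]⟩
    rw [map_mul] at hG₁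
    have hG := left_ne_zero_of_mul hG₁
    refine ⟨hG, ?_⟩
    rw [h₁.self_of_nhds, div_eq_div_iff (by rwa [map_mul]) hG, ← map_mul, ← map_mul, hcross]
  obtain ⟨G', hG'⟩ := (isUnit_of_forall_eval_ne_zero fun c => (hfrac c).1).exists_right_inv
  refine ⟨F * G', fun c => ?_⟩
  rw [(hfrac c).2, div_eq_iff (hfrac c).1, ← map_mul, mul_assoc, mul_comm G', hG', mul_one]

end RegularFunctions

section Weights

/-- The weights of the one-parameter subgroups of the torus acting on the fibres of `coxMap`. -/
def IsCoxWeight (w : Fin 6 → ℕ) : Prop :=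
  w 0 + w 5 = w 2 + w 4 ∧ w 1 + w 5 = w 2 + w 3 ∧ w 0 + w 3 = w 1 + w 4

theorem IsCoxWeight.comp_shiftPerm {w : Fin 6 → ℕ} (hw : IsCoxWeight w) :
    IsCoxWeight (w ∘ shiftPerm) := by
  simp only [IsCoxWeight, Function.comp_apply, shiftPerm, Equiv.coe_fn_mk, cons_val] at hw ⊢
  omega

theorem IsCoxWeight.comp_shiftPerm_pow {w : Fin 6 → ℕ} (hw : IsCoxWeight w) (n : ℕ) :
    IsCoxWeight (w ∘ (shiftPerm ^ n : Equiv.Perm (Fin 6))) := by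
  induction n with
  | zero => exact hw
  | succ n ih =>
    rw [pow_succ]
    exact ih.comp_shiftPerm

/-- The one-parameter subgroup with weights `w`, evaluated at `2`: since `2` is not a root of unity,
this value determines all weights. -/
def coxScale (w : Fin 6 → ℕ) (c : CoxSpace) : CoxSpace :=
  ⟨fun j => 2 ^ w j * c.1 j, by simpa using c.2⟩

theorem coxShift_iterate_coxScale (w : Fin 6 → ℕ) (n : ℕ) (c : CoxSpace) :
    coxShift^[n] (coxScale w c) =
      coxScale (w ∘ (shiftPerm ^ n : Equiv.Perm (Fin 6))) (coxShift^[n] c) :=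
  Subtype.ext <| funext fun k =>
    (coxShift_iterate_apply n (coxScale w c) k).trans
      (congr_arg (2 ^ w ((shiftPerm ^ n) k) * ·) (coxShift_iterate_apply n c k).symm)

variable {p : Fin 3 → Plane} (hp : Projectivization.Independent p) {w : Fin 6 → ℕ}

theorem coxMap_coxScale (hw : IsCoxWeight w) (c : CoxSpace) :
    coxMap hp (coxScale w c) = coxMap hp c := by
  obtain ⟨h0, h1, h2⟩ := hw
  have pow_eq {a b a' b' : ℕ} (h : a + b = a' + b') : (2 : ℂ) ^ a * 2 ^ b = 2 ^ a' * 2 ^ b' := by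
    rw [← pow_add, h, pow_add]
  rw [coxMap_eq_coxMap_iff]
  simp only [coxScale]
  refine ⟨?_, ?_, ?_⟩
  · linear_combination c.1 1 * c.1 5 * (c.1 2 * c.1 3) * pow_eq h1
  · linear_combination c.1 0 * c.1 5 * (c.1 2 * c.1 4) * pow_eq h0
  · linear_combination c.1 0 * c.1 3 * (c.1 1 * c.1 4) * pow_eq h2

theorem coxFrame_coxScale (hw : IsCoxWeight w) (i : Fin 3) (c : CoxSpace) :
    coxFrame i (coxScale w c) = 2 ^ w 0 * coxFrame i c := by
  obtain ⟨h0, -, h2⟩ := hw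
  fin_cases i
  · rfl
  · simp only [coxFrame, coxScale, Fin.mk_one, cons_val]
    rw [mul_mul_mul_comm, ← pow_add, ← h0, pow_add]
    field_simp
  · simp only [coxFrame, coxScale, Fin.reduceFinMk, cons_val]
    rw [mul_mul_mul_comm, ← pow_add, ← h2, pow_add]
    field_simp

theorem bind₁_C_mul_X_monomial {σ R : Type*} [CommSemiring R] (a : σ → R) (m : σ →₀ ℕ) (r : R) :
    bind₁ (fun j => C (a j) * X j) (monomial m r) =
      monomial m (m.prod (fun j e => a j ^ e) * r) := by
  rw [bind₁_monomial, monomial_eq, C_mul, mul_comm (C _) (C r), mul_assoc]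
  simp only [mul_pow, Finset.prod_mul_distrib, Finsupp.prod, map_prod, map_pow]

theorem coeff_bind₁_C_mul_X {σ R : Type*} [CommSemiring R] (a : σ → R) (m : σ →₀ ℕ)
    (F : MvPolynomial σ R) :
    coeff m (bind₁ (fun j => C (a j) * X j) F) = m.prod (fun j e => a j ^ e) * coeff m F := by
  classical
  induction F using MvPolynomial.induction_on' with
  | monomial m' r =>
    rw [bind₁_C_mul_X_monomial, coeff_monomial, coeff_monomial]
    split_ifs with h
    · rw [h]
    · rw [mul_zero]
  | add F G hF hG => rw [map_add, coeff_add, hF, hG, coeff_add, mul_add]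

theorem isWeightedHomogeneous_of_eval_coxScale {d : ℕ} {F : MvPolynomial (Fin 6) ℂ}
    (h : ∀ c, eval (coxScale w c).1 F = 2 ^ d * eval c.1 F) : IsWeightedHomogeneous w F d := by
  have hF : bind₁ (fun j => C ((2 : ℂ) ^ w j) * X j) F = C (2 ^ d) * F :=
    ext_of_eval_coxSpace fun c => by
      rw [map_mul, eval_C, ← h, eval, eval₂Hom_bind₁]
      simp only [map_mul, coe_eval₂Hom, eval₂_C, eval₂_X, RingHom.id_apply]
      rfl
  intro m hm
  have hcoeff := congr_arg (coeff m) hF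
  rw [coeff_bind₁_C_mul_X, coeff_C_mul] at hcoeff
  have hpow := mul_right_cancel₀ hm hcoeff
  simp only [Finsupp.prod, ← pow_mul, Finset.prod_pow_eq_pow_sum] at hpow
  rw [Finsupp.weight_apply, Finsupp.sum]
  simp only [smul_eq_mul, mul_comm (m _)]
  exact Nat.pow_right_injective le_rfl (by exact_mod_cast hpow)

end Weights

section TwistedFrames

variable {p : Fin 3 → Plane} (hp : Projectivization.Independent p) {n : ℕ}

/-- The line bundle `ℒ_n = ℒ ⊗ σ^*ℒ ⊗ ⋯ ⊗ (σ^*)ⁿ⁻¹ℒ`. -/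
abbrev coxTwist (n : ℕ) : LineBundle (BlowUp p) :=
  (coxBundle hp).twist (shiftAut hp) n

/-- The global sections of `ℒ_n`. -/
abbrev CoxPiece (n : ℕ) : Type :=
  TwistedPiece (coxBundle hp) (shiftAut hp) n

/-- The local frames of the pull-back of `ℒ_n`, induced by those of `ℒ` through `coxShift`. -/
def frameProd (I : Fin n → Fin 3) (c : CoxSpace) : ℂ :=
  ∏ k, coxFrame (I k) (coxShift^[(k : ℕ)] c)

theorem mem_coxTwist {I : Fin n → Fin 3} {c : CoxSpace} :
    coxMap hp c ∈ (coxTwist hp n).U I ↔ frameProd I c ≠ 0 := by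
  rw [frameProd, Finset.prod_ne_zero_iff]
  refine mem_twist.trans (forall_congr' fun k => ?_)
  rw [shiftAut_pow_coxMap]
  exact (mem_bundleOpen hp).trans (by simp)

theorem regularAt_frameProd {I : Fin n → Fin 3} {c : CoxSpace} (h : frameProd I c ≠ 0) :
    RegularAt (frameProd I) c :=
  .prod fun k hk => (isMorphism_coxShift.iterate k).regularAt_comp <|
    regularAt_coxFrame (Finset.prod_ne_zero_iff.1 h k hk)

theorem twist_g_coxMap (I J : Fin n → Fin 3) (c : CoxSpace)
    (hI : coxMap hp c ∈ (coxTwist hp n).U I) (hJ : coxMap hp c ∈ (coxTwist hp n).U J) :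
    (coxTwist hp n).g I J ⟨coxMap hp c, Opens.mem_inf.2 ⟨hI, hJ⟩⟩ =
      frameProd J c / frameProd I c := by
  rw [frameProd, frameProd, ← Finset.prod_div_distrib]
  refine (twist_g (L := coxBundle hp) (σ := shiftAut hp) I J _ hI hJ).trans
    (Finset.prod_congr rfl fun k _ => ?_)
  exact (congrArg (frameRatio hp (I k) (J k)) (shiftAut_pow_coxMap hp k c)).trans
    (frameRatio_coxMap hp (I k) (J k) _)

/-- The polynomials that transform along the fibres of `coxMap` like the frames of `ℒ_n`. -/
def IsSemiInvariant (n : ℕ) (F : MvPolynomial (Fin 6) ℂ) : Prop :=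
  ∀ c c', coxMap hp c = coxMap hp c' → ∀ I : Fin n → Fin 3,
    eval c.1 F * frameProd I c' = eval c'.1 F * frameProd I c

theorem isSemiInvariant_X : IsSemiInvariant hp 1 (X 0) := fun c c' h I => by
  simp only [eval_X, frameProd, Fin.prod_univ_one, Fin.val_zero, Function.iterate_zero, id_eq]
  exact (coxFrame_mul_coxFrame hp h 0 (I 0)).trans (mul_comm _ _)

theorem exists_coxFrame_mul_coxFrame {c c' : CoxSpace} (h : coxMap hp c = coxMap hp c') :
    ∃ i j, coxFrame i c * coxFrame j (coxShift c) = c.1 2 * c.1 4 ∧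
      coxFrame i c' * coxFrame j (coxShift c') = c'.1 2 * c'.1 4 := by
  have h' := eq_zero_iff_of_coxMap_eq hp h
  suffices ∃ i j, ∀ c', (∀ k, c.1 k = 0 ↔ c'.1 k = 0) →
      coxFrame i c' * coxFrame j (coxShift c') = c'.1 2 * c'.1 4 by
    obtain ⟨i, j, hij⟩ := this
    exact ⟨i, j, hij c fun _ => Iff.rfl, hij c' h'⟩
  by_cases h5 : c.1 5 = 0
  · by_cases h0 : c.1 0 = 0
    · have h1 : c.1 1 ≠ 0 := fun h1 => c.2.2.2.2.1 ⟨h0, h1⟩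
      have h3 : c.1 3 ≠ 0 := fun h3 => c.2.2.2.2.2.2.2.2.2 ⟨h3, h5⟩
      refine ⟨2, 1, fun c' hc' => ?_⟩
      have h1' := (hc' 1).not.1 h1
      have h3' := (hc' 3).not.1 h3
      simp only [coxFrame, coxShift_apply, shiftPerm, Equiv.coe_fn_mk, cons_val]
      field_simp
    · refine ⟨0, 2, fun c' hc' => ?_⟩
      have h0' := (hc' 0).not.1 h0
      simp only [coxFrame, coxShift_apply, shiftPerm, Equiv.coe_fn_mk, cons_val]
      field_simp
  · refine ⟨1, 0, fun c' hc' => ?_⟩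
    have h5' := (hc' 5).not.1 h5
    simp only [coxFrame, coxShift_apply, shiftPerm, Equiv.coe_fn_mk, cons_val]
    field_simp

theorem isSemiInvariant_ZT : IsSemiInvariant hp 2 (X 2 * X 4) := fun c c' h I => by
  obtain ⟨i, j, hc, hc'⟩ := exists_coxFrame_mul_coxFrame hp h
  have h0 := coxFrame_mul_coxFrame hp h i (I 0)
  have h1 := coxFrame_mul_coxFrame hp (coxMap_coxShift_eq hp h) j (I 1)
  simp only [frameProd, Fin.prod_univ_two, map_mul, eval_X, Fin.val_zero, Fin.val_one,
    Function.iterate_zero, id_eq, Function.iterate_one, ← hc, ← hc']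
  linear_combination coxFrame j (coxShift c) * coxFrame (I 1) (coxShift c') * h0 +
    coxFrame (I 0) c * coxFrame i c' * h1

variable {hp} {F : MvPolynomial (Fin 6) ℂ}

theorem IsSemiInvariant.div_frameProd_coxLift (hF : IsSemiInvariant hp n F) {I : Fin n → Fin 3}
    {c : CoxSpace} (h : coxMap hp c ∈ (coxTwist hp n).U I) :
    eval (coxLift hp (coxMap hp c)).1 F / frameProd I (coxLift hp (coxMap hp c)) =
      eval c.1 F / frameProd I c := by
  have hc := coxMap_coxLift hp (coxMap hp c)
  rw [div_eq_div_iff ((mem_coxTwist hp).1 (hc.symm ▸ h)) ((mem_coxTwist hp).1 h)]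
  exact hF _ _ hc I

theorem IsSemiInvariant.regularAt_div_frameProd (hF : IsSemiInvariant hp n F) {I : Fin n → Fin 3}
    {b : BlowUp p} (hb : b ∈ (coxTwist hp n).U I) :
    RegularAt (fun b => eval (coxLift hp b).1 F / frameProd I (coxLift hp b)) b := by
  refine regularAt_of_comp_coxMap hp fun c hc => ?_
  have h0 := (mem_coxTwist hp).1 (hc.symm ▸ hb)
  refine ((regularAt_eval F c).div (regularAt_frameProd h0) h0).congr ?_
  filter_upwards [(regularAt_frameProd h0).eventually_ne_zero h0] with c' hc'
  exact (hF.div_frameProd_coxLift ((mem_coxTwist hp).2 hc')).symm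

/-- The section of `ℒ_n` whose pull-back is a given polynomial. -/
def IsSemiInvariant.toSection (hF : IsSemiInvariant hp n F) : CoxPiece hp n :=
  ⟨fun I b => eval (coxLift hp b).1 F / frameProd I (coxLift hp b),
    fun _ => mem_reg_of_regularAt (fun _ => rfl) fun _ hb => hF.regularAt_div_frameProd hb,
    fun I J b hI hJ => by
      obtain ⟨c, rfl⟩ := (isQuotientMap_coxMap hp).surjective b
      have hg := twist_g_coxMap hp I J c hI hJ
      refine (hF.div_frameProd_coxLift hI).trans
        (Eq.trans ?_ (congrArg₂ (· * ·) hg (hF.div_frameProd_coxLift hJ)).symm)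
      rw [mul_comm, div_mul_div_cancel₀ ((mem_coxTwist hp).1 hJ)]⟩

theorem IsSemiInvariant.represents_toSection (hF : IsSemiInvariant hp n F) :
    (coxTrivialization hp).Represents hF.toSection F := fun I c h =>
  (congrArg (· * frameProd I c) (hF.div_frameProd_coxLift h)).trans
    (div_mul_cancel₀ _ ((mem_coxTwist hp).1 h))

end TwistedFrames

section Represents

variable {p : Fin 3 → Plane} {hp : Projectivization.Independent p} {m n : ℕ}
  {s t : CoxPiece hp n} {F G : MvPolynomial (Fin 6) ℂ}

theorem represents_ext (hs : (coxTrivialization hp).Represents s F)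
    (ht : (coxTrivialization hp).Represents t F) : s = t := by
  refine Subtype.ext <| funext fun I => funext fun ⟨b, hb⟩ => ?_
  obtain ⟨c, rfl⟩ := (isQuotientMap_coxMap hp).surjective b
  exact mul_right_cancel₀ ((mem_coxTwist hp).1 hb) ((hs I c hb).trans (ht I c hb).symm)

theorem represents_unique (hF : (coxTrivialization hp).Represents s F)
    (hG : (coxTrivialization hp).Represents s G) : F = G :=
  ext_of_eval_coxSpace fun c => by
    obtain ⟨I, hI⟩ := (coxTwist hp n).cover (coxMap hp c)
    rw [← hF I c hI, ← hG I c hI]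

theorem represents_add (hs : (coxTrivialization hp).Represents s F)
    (ht : (coxTrivialization hp).Represents t G) :
    (coxTrivialization hp).Represents (s + t) (F + G) := fun I c h => by
  rw [map_add, ← hs I c h, ← ht I c h, ← add_mul]
  rfl

theorem represents_smul (a : ℂ) (hs : (coxTrivialization hp).Represents s F) :
    (coxTrivialization hp).Represents (a • s) (a • F) := fun I c h => by
  rw [smul_eval, ← hs I c h, ← mul_assoc]
  rfl

theorem represents_one :
    (coxTrivialization hp).Represents (GradedMonoid.GOne.one : CoxPiece hp 0) 1 := fun I c h => by
  rw [Fin.prod_univ_zero, mul_one, map_one]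
  rfl

theorem eval_coxShift_iterate (n : ℕ) (c : CoxSpace) (F : MvPolynomial (Fin 6) ℂ) :
    eval (coxShift^[n] c).1 F = eval c.1 (rename (shiftPerm ^ n : Equiv.Perm (Fin 6)) F) := by
  rw [eval_rename, funext (coxShift_iterate_apply n c)]
  rfl

theorem represents_mul {s : CoxPiece hp m} (hs : (coxTrivialization hp).Represents s F)
    (ht : (coxTrivialization hp).Represents t G) :
    (coxTrivialization hp).Represents (twistedMul s t)
      (F * rename (shiftPerm ^ m : Equiv.Perm (Fin 6)) G) := fun I c h => by
  have hr : coxMap hp (coxShift^[m] c) ∈ (coxTwist hp n).U fun k => I (Fin.natAdd m k) := by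
    rw [← shiftAut_pow_coxMap]
    exact twist_right h
  rw [map_mul, ← eval_coxShift_iterate, ← hs _ c (twist_left h), ← ht _ _ hr, twistedMul_apply,
    Fin.prod_univ_add, mul_mul_mul_comm]
  congr 2
  · exact H0_congr t rfl (shiftAut_pow_coxMap hp m c) _ _
  · refine Finset.prod_congr rfl fun k _ => ?_
    rw [Fin.val_natAdd, add_comm, Function.iterate_add_apply]

theorem section_mul_frameProd (s : CoxPiece hp n) {I J : Fin n → Fin 3} {c : CoxSpace}
    (hI : coxMap hp c ∈ (coxTwist hp n).U I) (hJ : coxMap hp c ∈ (coxTwist hp n).U J) :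
    s.1 I ⟨coxMap hp c, hI⟩ * frameProd I c = s.1 J ⟨coxMap hp c, hJ⟩ * frameProd J c := by
  rw [(s.2.2 I J (coxMap hp c) hI hJ).trans
    (congrArg (· * _) (twist_g_coxMap hp I J c hI hJ)), mul_right_comm,
    div_mul_cancel₀ _ ((mem_coxTwist hp).1 hI), mul_comm]

theorem exists_represents (s : CoxPiece hp n) :
    ∃ F, (coxTrivialization hp).Represents s F := by
  choose I hI using fun c => (coxTwist hp n).cover (coxMap hp c)
  have hreg (c : CoxSpace) :
      RegularAt (fun c' => s.1 (I c') ⟨coxMap hp c', hI c'⟩ * frameProd (I c') c') c := by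
    obtain ⟨f, hf⟩ := exists_extension (s.1 (I c))
    have h0 := (mem_coxTwist hp).1 (hI c)
    refine (((isMorphism_coxMap hp).regularAt_comp
      (regularAt_of_mem_reg (s.2.1 (I c)) hf (hI c))).mul (regularAt_frameProd h0)).congr ?_
    filter_upwards [(regularAt_frameProd h0).eventually_ne_zero h0] with c' hc'
    have hc := (mem_coxTwist hp).2 hc'
    rw [section_mul_frameProd s (hI c') hc, hf ⟨_, hc⟩]
    rfl
  obtain ⟨F, hF⟩ := exists_polynomial_of_regularAt hreg
  exact ⟨F, fun J c h => (section_mul_frameProd s h (hI c)).trans (hF c)⟩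

theorem frameProd_coxScale {w : Fin 6 → ℕ} (hw : IsCoxWeight w) (I : Fin n → Fin 3)
    (c : CoxSpace) : frameProd I (coxScale w c) =
      2 ^ (∑ k ∈ Finset.range n, w ((shiftPerm ^ k) 0)) * frameProd I c := by
  rw [frameProd, frameProd, ← Finset.prod_pow_eq_pow_sum, Finset.prod_range,
    ← Finset.prod_mul_distrib]
  refine Finset.prod_congr rfl fun k _ => ?_
  rw [coxShift_iterate_coxScale, coxFrame_coxScale (hw.comp_shiftPerm_pow k)]
  rfl

theorem isWeightedHomogeneous_of_represents (hs : (coxTrivialization hp).Represents s F)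
    {w : Fin 6 → ℕ} (hw : IsCoxWeight w) :
    IsWeightedHomogeneous w F (∑ k ∈ Finset.range n, w ((shiftPerm ^ k) 0)) :=
  isWeightedHomogeneous_of_eval_coxScale fun c => by
    obtain ⟨I, hI⟩ := (coxTwist hp n).cover (coxMap hp c)
    have hI' : coxMap hp (coxScale w c) ∈ (coxTwist hp n).U I := by rwa [coxMap_coxScale hp hw]
    calc eval (coxScale w c).1 F
        = s.1 I ⟨coxMap hp (coxScale w c), hI'⟩ * frameProd I (coxScale w c) := (hs I _ hI').symm
      _ = s.1 I ⟨coxMap hp c, hI⟩ *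
          (2 ^ (∑ k ∈ Finset.range n, w ((shiftPerm ^ k) 0)) * frameProd I c) :=
        congrArg₂ (· * ·) (H0_congr s rfl (coxMap_coxScale hp hw c) hI' hI)
          (frameProd_coxScale hw I c)
      _ = _ := by
        rw [mul_left_comm, ← hs I c hI]
        rfl

end Represents

/-! ### Monomials and normal forms -/

section Exponents

theorem shiftPerm_pow_zero (k : ℕ) :
    (shiftPerm ^ k) 0 = ![0, 5, 1, 4, 2, 3] ⟨k % 6, Nat.mod_lt _ (by norm_num)⟩ := by
  have h6 : shiftPerm ^ 6 = 1 := by decide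
  have table : ∀ r : Fin 6, (shiftPerm ^ (r : ℕ)) 0 = ![0, 5, 1, 4, 2, 3] r := by decide
  rw [pow_eq_pow_mod k h6]
  exact table ⟨k % 6, _⟩

theorem sum_shiftPerm (w : Fin 6 → ℕ) (n : ℕ) :
    ∑ k ∈ Finset.range n, w ((shiftPerm ^ k) 0) =
      w 0 * ((n + 5) / 6) + w 5 * ((n + 4) / 6) + w 1 * ((n + 3) / 6) + w 4 * ((n + 2) / 6) +
        w 2 * ((n + 1) / 6) + w 3 * (n / 6) := by
  induction n with
  | zero => simp
  | succ n ih =>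
    rw [Finset.sum_range_succ, ih, shiftPerm_pow_zero]
    obtain ⟨q, r, hr, rfl⟩ : ∃ q r, r < 6 ∧ n = 6 * q + r :=
      ⟨n / 6, n % 6, Nat.mod_lt _ (by norm_num), (Nat.div_add_mod n 6).symm⟩
    simp only [Nat.mul_add_mod, Nat.mod_eq_of_lt hr, add_assoc,
      Nat.mul_add_div (by norm_num : 0 < 6)]
    interval_cases r <;> simp <;> ring

/-- The exponents of the monomials whose class in the Picard group is that of `ℒ_n`. The four
equations compare degrees for a basis of the one-parameter subgroups acting on the fibres of
`coxMap`, namely those of weights `X t`, `Z u`, `Y s` and `X Y Z`. -/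
def IsTwistExponent (n : ℕ) (m : Fin 6 → ℕ) : Prop :=
  m 0 + m 4 = (n + 5) / 6 + (n + 2) / 6 ∧ m 2 + m 5 = (n + 4) / 6 + (n + 1) / 6 ∧
    m 1 + m 3 = (n + 3) / 6 + n / 6 ∧ m 0 + m 1 + m 2 = (n + 5) / 6 + (n + 3) / 6 + (n + 1) / 6

theorem isTwistExponent_of_represents {p : Fin 3 → Plane} {hp : Projectivization.Independent p}
    {n : ℕ} {s : CoxPiece hp n} {F : MvPolynomial (Fin 6) ℂ} {m : Fin 6 →₀ ℕ}
    (hs : (coxTrivialization hp).Represents s F) (hm : F.coeff m ≠ 0) : IsTwistExponent n m := by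
  have key (w : Fin 6 → ℕ) (hw : IsCoxWeight w) :=
    (isWeightedHomogeneous_of_represents hs hw hm).trans (sum_shiftPerm w n)
  have h1 := key ![1, 0, 0, 0, 1, 0] ⟨rfl, rfl, rfl⟩
  have h2 := key ![0, 0, 1, 0, 0, 1] ⟨rfl, rfl, rfl⟩
  have h3 := key ![0, 1, 0, 1, 0, 0] ⟨rfl, rfl, rfl⟩
  have h4 := key ![1, 1, 1, 0, 0, 0] ⟨rfl, rfl, rfl⟩
  simp [Finsupp.weight_apply, Finsupp.sum_fintype, Fin.sum_univ_six] at h1 h2 h3 h4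
  unfold IsTwistExponent
  omega

/-- Left multiplication by `x` on exponents: the monomial `m` goes to `X * σ^* m`. -/
def xMul (m : Fin 6 → ℕ) : Fin 6 → ℕ := ![m 3 + 1, m 5, m 4, m 2, m 1, m 0]

/-- Left multiplication by `y` on exponents: the monomial `m` goes to `Z * t * (σ^*)² m`. -/
def yMul (m : Fin 6 → ℕ) : Fin 6 → ℕ := ![m 2, m 0, m 1 + 1, m 4, m 5 + 1, m 3]

/-- Left division by `x`; the inverse of `xMul` on the exponents `m` with `m 0 ≠ 0`. -/
def xDiv (m : Fin 6 → ℕ) : Fin 6 → ℕ := ![m 5, m 4, m 3, m 0 - 1, m 2, m 1]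

/-- Left division by `y`; the inverse of `yMul` on the exponents `m` with `m 2, m 4 ≠ 0`. -/
def yDiv (m : Fin 6 → ℕ) : Fin 6 → ℕ := ![m 1, m 2 - 1, m 0, m 5, m 3, m 4 - 1]

theorem xDiv_xMul (m : Fin 6 → ℕ) : xDiv (xMul m) = m := by
  funext j
  fin_cases j <;> rfl

theorem yDiv_yMul (m : Fin 6 → ℕ) : yDiv (yMul m) = m := by
  funext j
  fin_cases j <;> rfl

theorem xMul_xDiv {m : Fin 6 → ℕ} (h : m 0 ≠ 0) : xMul (xDiv m) = m := by
  funext j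
  fin_cases j
  exacts [Nat.sub_add_cancel (Nat.pos_of_ne_zero h), rfl, rfl, rfl, rfl, rfl]

theorem yMul_yDiv {m : Fin 6 → ℕ} (h2 : m 2 ≠ 0) (h4 : m 4 ≠ 0) : yMul (yDiv m) = m := by
  funext j
  fin_cases j
  exacts [rfl, rfl, Nat.sub_add_cancel (Nat.pos_of_ne_zero h2), rfl,
    Nat.sub_add_cancel (Nat.pos_of_ne_zero h4), rfl]

theorem yMul_yMul (m : Fin 6 → ℕ) : yMul (yMul m) = xMul (yMul (xMul m)) := by
  funext j
  fin_cases j <;> rfl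

theorem yMul_xMul_yMul (m : Fin 6 → ℕ) :
    yMul (xMul (yMul m)) = xMul (xMul (xMul (xMul (xMul m)))) := by
  funext j
  fin_cases j <;> rfl

namespace IsTwistExponent

variable {n : ℕ} {m : Fin 6 → ℕ}

theorem xMul (h : IsTwistExponent n m) : IsTwistExponent (n + 1) (xMul m) := by
  simp only [IsTwistExponent, DelPezzo.xMul, Matrix.cons_val] at *
  omega

theorem yMul (h : IsTwistExponent n m) : IsTwistExponent (n + 2) (yMul m) := by
  simp only [IsTwistExponent, DelPezzo.yMul, Matrix.cons_val] at *
  omega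

theorem exists_xMul (h : IsTwistExponent n m) (h0 : m 0 ≠ 0) :
    ∃ k m', n = k + 1 ∧ IsTwistExponent k m' ∧ m = DelPezzo.xMul m' := by
  obtain _ | k := n
  · unfold IsTwistExponent at h
    omega
  · refine ⟨k, xDiv m, rfl, ?_, (xMul_xDiv h0).symm⟩
    simp only [IsTwistExponent, xDiv, Matrix.cons_val] at *
    omega

theorem exists_yMul (h : IsTwistExponent n m) (h2 : m 2 ≠ 0) (h4 : m 4 ≠ 0) :
    ∃ k m', n = k + 2 ∧ IsTwistExponent k m' ∧ m = DelPezzo.yMul m' := by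
  obtain _ | _ | k := n
  · unfold IsTwistExponent at h
    omega
  · unfold IsTwistExponent at h
    omega
  · refine ⟨k, yDiv m, rfl, ?_, (yMul_yDiv h2 h4).symm⟩
    simp only [IsTwistExponent, yDiv, Matrix.cons_val] at *
    omega

theorem ne_zero_of_eq_zero (h : IsTwistExponent n m) (hn : n ≠ 0) (h0 : m 0 = 0) :
    m 2 ≠ 0 ∧ m 4 ≠ 0 := by
  unfold IsTwistExponent at h
  omega

theorem ne_zero_of_ne_zero (h : IsTwistExponent n m) (h2 : m 2 ≠ 0) (h4 : m 4 = 0) :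
    m 0 ≠ 0 ∧ m 3 ≠ 0 := by
  unfold IsTwistExponent at h
  omega

theorem eq_zero (h : IsTwistExponent 0 m) : m = 0 := by
  unfold IsTwistExponent at h
  funext j
  fin_cases j <;> simp <;> omega

end IsTwistExponent

theorem gen_zero_pow : gen 0 ^ 5 = gen 1 * gen 0 * gen 1 := by
  have h := RingQuot.mkAlgHom_rel ℂ Rel.first
  rw [map_pow, map_mul, map_mul] at h
  exact h

theorem gen_one_sq : gen 1 ^ 2 = gen 0 * gen 1 * gen 0 := by
  have h := RingQuot.mkAlgHom_rel ℂ Rel.second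
  rw [map_pow, map_mul, map_mul] at h
  exact h

/-- The normal form in `R` of the words of weight `n` and exponents `m`: it starts with `x` whenever
the monomial is divisible by `X`. It is only meaningful for `IsTwistExponent n m`. -/
def normalWord : ℕ → (Fin 6 → ℕ) → AlgR
  | 0, _ => 1
  | 1, _ => gen 0
  | n + 2, m => if m 0 = 0 then gen 1 * normalWord n (yDiv m) else
      gen 0 * normalWord (n + 1) (xDiv m)

theorem normalWord_xMul (n : ℕ) (m : Fin 6 → ℕ) :
    normalWord (n + 1) (xMul m) = gen 0 * normalWord n m := by
  cases n with
  | zero => rw [normalWord, normalWord, mul_one]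
  | succ n =>
    rw [normalWord, if_neg (show xMul m 0 ≠ 0 from Nat.succ_ne_zero _), xDiv_xMul]

theorem normalWord_yMul (n : ℕ) {m : Fin 6 → ℕ} (hm : IsTwistExponent n m) :
    normalWord (n + 2) (yMul m) = gen 1 * normalWord n m := by
  induction n using Nat.strong_induction_on generalizing m with
  | _ n ih =>
    by_cases h2 : m 2 = 0
    · rw [normalWord, if_pos (show yMul m 0 = 0 from h2), yDiv_yMul]
    by_cases h4 : m 4 = 0
    · obtain ⟨h0, h3⟩ := hm.ne_zero_of_ne_zero h2 h4
      obtain ⟨k, m', rfl, hm', rfl⟩ := hm.exists_xMul h0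
      obtain ⟨k, m'', rfl, hm'', rfl⟩ := hm'.exists_yMul (show m' 2 ≠ 0 from h3)
        (show m' 4 ≠ 0 from h2)
      rw [yMul_xMul_yMul, normalWord_xMul, normalWord_xMul, normalWord_xMul, normalWord_xMul,
        normalWord_xMul, normalWord_xMul, ih k (by omega) hm'']
      simp only [← mul_assoc]
      rw [← gen_zero_pow]
      simp only [pow_succ, pow_zero, one_mul]
    · obtain ⟨k, m', rfl, hm', rfl⟩ := hm.exists_yMul h2 h4
      rw [yMul_yMul, normalWord_xMul, ih (k + 1) (by omega) hm'.xMul, normalWord_xMul,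
        ih k (by omega) hm']
      simp only [← mul_assoc]
      rw [← gen_one_sq, sq]

/-- The weight of a word in `x` (the letter `0`, of weight `1`) and `y` (of weight `2`). -/
def wordWeight (w : List (Fin 2)) : ℕ := (w.map ![1, 2]).sum

theorem wordWeight_cons (i : Fin 2) (w : List (Fin 2)) :
    wordWeight (i :: w) = wordWeight w + ![1, 2] i := by
  rw [wordWeight, List.map_cons, List.sum_cons, add_comm, wordWeight]

/-- The exponents of the monomial that represents a word in the twisted ring. -/
def wordExp : List (Fin 2) → Fin 6 → ℕ
  | [] => 0
  | i :: w => (![xMul, yMul] i) (wordExp w)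

theorem isTwistExponent_wordExp (w : List (Fin 2)) :
    IsTwistExponent (wordWeight w) (wordExp w) := by
  induction w with
  | nil => simp [IsTwistExponent, wordWeight, wordExp]
  | cons i w ih =>
    rw [wordWeight_cons]
    fin_cases i
    exacts [ih.xMul, ih.yMul]

theorem prod_gen_eq_normalWord (w : List (Fin 2)) :
    (w.map gen).prod = normalWord (wordWeight w) (wordExp w) := by
  induction w with
  | nil => rfl
  | cons i w ih =>
    rw [wordWeight_cons, List.map_cons, List.prod_cons, ih]
    fin_cases i
    exacts [(normalWord_xMul _ _).symm, (normalWord_yMul _ (isTwistExponent_wordExp w)).symm]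

theorem exists_word {n : ℕ} {m : Fin 6 → ℕ} (h : IsTwistExponent n m) :
    ∃ w, wordWeight w = n ∧ wordExp w = m := by
  induction n using Nat.strong_induction_on generalizing m with
  | _ n ih =>
    by_cases hn : n = 0
    · subst hn
      exact ⟨[], rfl, h.eq_zero.symm⟩
    by_cases h0 : m 0 = 0
    · obtain ⟨h2, h4⟩ := h.ne_zero_of_eq_zero hn h0
      obtain ⟨k, m', rfl, hm', rfl⟩ := h.exists_yMul h2 h4
      obtain ⟨w, rfl, rfl⟩ := ih k (by omega) hm'
      exact ⟨1 :: w, by simp [wordWeight, add_comm], rfl⟩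
    · obtain ⟨k, m', rfl, hm', rfl⟩ := h.exists_xMul h0
      obtain ⟨w, rfl, rfl⟩ := ih k (by omega) hm'
      exact ⟨0 :: w, by simp [wordWeight, add_comm], rfl⟩

theorem span_words : Submodule.span ℂ {r | ∃ w : List (Fin 2), r = (w.map gen).prod} = ⊤ := by
  have h1 : Algebra.adjoin ℂ (Set.range gen) = ⊤ := by
    have h := congrArg (Subalgebra.map (RingQuot.mkAlgHom ℂ Rel))
      (FreeAlgebra.adjoin_range_ι (R := ℂ) (X := Fin 2))
    rw [AlgHom.map_adjoin, ← Set.range_comp, Algebra.map_top,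
      (AlgHom.range_eq_top _).2 (RingQuot.mkAlgHom_surjective ℂ Rel)] at h
    exact h
  have h2 := Algebra.adjoin_eq_span (R := ℂ) (s := Set.range gen)
  rw [h1, Algebra.top_toSubmodule] at h2
  rw [eq_top_iff, h2]
  refine Submodule.span_mono fun r hr => ?_
  obtain ⟨l, hl, rfl⟩ := Submonoid.exists_list_of_mem_closure hr
  obtain ⟨w, rfl⟩ : ∃ w : List (Fin 2), w.map gen = l := by
    rw [← Set.mem_range, Set.range_list_map]
    exact hl
  exact ⟨w, rfl⟩

end Exponents

section Isomorphism

/-- The monomial with exponents `m`. -/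
def expMonomial (m : Fin 6 → ℕ) : MvPolynomial (Fin 6) ℂ :=
  monomial (Finsupp.equivFunOnFinite.symm m) 1

theorem expMonomial_eq_prod (m : Fin 6 → ℕ) : expMonomial m = ∏ j, X j ^ m j := by
  rw [expMonomial, monomial_eq, map_one, one_mul, Finsupp.prod_fintype _ _ fun i => pow_zero _]
  rfl

theorem X_mul_rename_expMonomial (m : Fin 6 → ℕ) :
    X 0 * rename (shiftPerm ^ 1 : Equiv.Perm (Fin 6)) (expMonomial m) = expMonomial (xMul m) := by
  simp only [expMonomial_eq_prod, Fin.prod_univ_six, map_mul, map_pow, rename_X]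
  rw [show (shiftPerm ^ 1) 0 = 5 from rfl, show (shiftPerm ^ 1) 1 = 4 from rfl,
    show (shiftPerm ^ 1) 2 = 3 from rfl, show (shiftPerm ^ 1) 3 = 0 from rfl,
    show (shiftPerm ^ 1) 4 = 2 from rfl, show (shiftPerm ^ 1) 5 = 1 from rfl]
  simp only [xMul, cons_val]
  ring

theorem ZT_mul_rename_expMonomial (m : Fin 6 → ℕ) :
    X 2 * X 4 * rename (shiftPerm ^ 2 : Equiv.Perm (Fin 6)) (expMonomial m) =
      expMonomial (yMul m) := by
  simp only [expMonomial_eq_prod, Fin.prod_univ_six, map_mul, map_pow, rename_X]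
  rw [show (shiftPerm ^ 2) 0 = 1 from rfl, show (shiftPerm ^ 2) 1 = 2 from rfl,
    show (shiftPerm ^ 2) 2 = 0 from rfl, show (shiftPerm ^ 2) 3 = 5 from rfl,
    show (shiftPerm ^ 2) 4 = 3 from rfl, show (shiftPerm ^ 2) 5 = 4 from rfl]
  simp only [yMul, cons_val]
  ring

variable {p : Fin 3 → Plane} (hp : Projectivization.Independent p)

/-- The section of `ℒ₁` with pull-back `X`; the image of `x`. -/
def sectionX : CoxPiece hp 1 := (isSemiInvariant_X hp).toSection

/-- The section of `ℒ₂` with pull-back `Z t`; the image of `y`. -/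
def sectionY : CoxPiece hp 2 := (isSemiInvariant_ZT hp).toSection

theorem represents_sectionX : (coxTrivialization hp).Represents (sectionX hp) (X 0) :=
  (isSemiInvariant_X hp).represents_toSection

theorem represents_sectionY : (coxTrivialization hp).Represents (sectionY hp) (X 2 * X 4) :=
  (isSemiInvariant_ZT hp).represents_toSection

/-- The images in the twisted ring of the generators `x` and `y` of `R`. -/
def twistedGen : Fin 2 → TwistedRing (coxBundle hp) (shiftAut hp) :=
  ![DirectSum.of (CoxPiece hp) 1 (sectionX hp), DirectSum.of (CoxPiece hp) 2 (sectionY hp)]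

theorem exists_of_mul_of_eq {k l n : ℕ} {s : CoxPiece hp k} {t : CoxPiece hp l}
    {F G E : MvPolynomial (Fin 6) ℂ} (hs : (coxTrivialization hp).Represents s F)
    (ht : (coxTrivialization hp).Represents t G) (hn : k + l = n)
    (hE : F * rename (shiftPerm ^ k : Equiv.Perm (Fin 6)) G = E) :
    ∃ r : CoxPiece hp n,
      DirectSum.of (CoxPiece hp) k s * DirectSum.of (CoxPiece hp) l t =
        DirectSum.of (CoxPiece hp) n r ∧
      (coxTrivialization hp).Represents r E := by
  subst hn hE
  exact ⟨twistedMul s t, DirectSum.of_mul_of _ _, represents_mul hs ht⟩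

theorem exists_word_section (w : List (Fin 2)) : ∃ s : CoxPiece hp (wordWeight w),
    (w.map (twistedGen hp)).prod = DirectSum.of (CoxPiece hp) (wordWeight w) s ∧
      (coxTrivialization hp).Represents s (expMonomial (wordExp w)) := by
  induction w with
  | nil =>
    refine ⟨twistedScalar 1, rfl, ?_⟩
    rw [show expMonomial (wordExp []) = 1 by simp [expMonomial_eq_prod, wordExp]]
    exact represents_one
  | cons i w ih =>
    obtain ⟨s, hs, hr⟩ := ih
    rw [List.map_cons, List.prod_cons, hs]
    have hw := (add_comm _ _).trans (wordWeight_cons i w).symm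
    fin_cases i
    · exact exists_of_mul_of_eq hp (represents_sectionX hp) hr hw (X_mul_rename_expMonomial _)
    · exact exists_of_mul_of_eq hp (represents_sectionY hp) hr hw (ZT_mul_rename_expMonomial _)

theorem prod_twistedGen_eq {w w' : List (Fin 2)} (h : wordWeight w = wordWeight w')
    (h' : wordExp w = wordExp w') :
    (w.map (twistedGen hp)).prod = (w'.map (twistedGen hp)).prod := by
  obtain ⟨s, hs, hr⟩ := exists_word_section hp w
  obtain ⟨s', hs', hr'⟩ := exists_word_section hp w'
  rw [hs, hs']
  rw [← h'] at hr'
  generalize wordWeight w' = n at h s'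
  subst h
  rw [represents_ext hr hr']

theorem twistedGen_zero_pow :
    twistedGen hp 0 ^ 5 = twistedGen hp 1 * twistedGen hp 0 * twistedGen hp 1 := by
  simpa [pow_succ, mul_assoc] using
    prod_twistedGen_eq hp (w := List.replicate 5 0) (w' := [1, 0, 1]) rfl (by decide)

theorem twistedGen_one_sq :
    twistedGen hp 1 ^ 2 = twistedGen hp 0 * twistedGen hp 1 * twistedGen hp 0 := by
  simpa [sq, mul_assoc] using
    prod_twistedGen_eq hp (w := List.replicate 2 1) (w' := [0, 1, 0]) rfl (by decide)

/-- The homomorphism `R → B(B₃, ℒ, σ)` with `x ↦ X` and `y ↦ Z t`. -/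
def toTwisted : AlgR →ₐ[ℂ] TwistedRing (coxBundle hp) (shiftAut hp) :=
  RingQuot.liftAlgHom ℂ ⟨FreeAlgebra.lift ℂ (twistedGen hp), by
    rintro _ _ (_ | _)
    · rw [map_pow, map_mul, map_mul, FreeAlgebra.lift_ι_apply, FreeAlgebra.lift_ι_apply]
      exact twistedGen_zero_pow hp
    · rw [map_pow, map_mul, map_mul, FreeAlgebra.lift_ι_apply, FreeAlgebra.lift_ι_apply]
      exact twistedGen_one_sq hp⟩

theorem toTwisted_gen (i : Fin 2) : toTwisted hp (gen i) = twistedGen hp i := by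
  rw [toTwisted, gen, RingQuot.liftAlgHom_mkAlgHom_apply, FreeAlgebra.lift_ι_apply]

theorem toTwisted_word (w : List (Fin 2)) :
    toTwisted hp (w.map gen).prod = (w.map (twistedGen hp)).prod := by
  rw [map_list_prod, List.map_map]
  congr 2
  exact funext (toTwisted_gen hp)

/-- The polynomial on `ℂ⁶` that represents a section of `ℒ_n`. -/
def toPoly (n : ℕ) : CoxPiece hp n →ₗ[ℂ] MvPolynomial (Fin 6) ℂ where
  toFun s := (exists_represents s).choose
  map_add' s t := represents_unique (exists_represents (s + t)).choose_spec
    (represents_add (exists_represents s).choose_spec (exists_represents t).choose_spec)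
  map_smul' a s := represents_unique (exists_represents (a • s)).choose_spec
    (represents_smul a (exists_represents s).choose_spec)

theorem represents_toPoly {n : ℕ} (s : CoxPiece hp n) :
    (coxTrivialization hp).Represents s (toPoly hp n s) :=
  (exists_represents s).choose_spec

variable {hp} in
theorem toPoly_eq {n : ℕ} {s : CoxPiece hp n} {F : MvPolynomial (Fin 6) ℂ}
    (hs : (coxTrivialization hp).Represents s F) : toPoly hp n s = F :=
  represents_unique (represents_toPoly hp s) hs

theorem toPoly_injective (n : ℕ) : Function.Injective (toPoly hp n) := fun s t h =>
  represents_ext (represents_toPoly hp s) (h ▸ represents_toPoly hp t)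

/-- The linear left inverse of `toTwisted` that sends each monomial to its normal form in `R`. -/
def ofTwisted : TwistedRing (coxBundle hp) (shiftAut hp) →ₗ[ℂ] AlgR :=
  DirectSum.toModule ℂ ℕ AlgR fun n =>
    ((basisMonomials (Fin 6) ℂ).constr ℂ fun m => normalWord n m) ∘ₗ toPoly hp n

theorem ofTwisted_of {n : ℕ} {m : Fin 6 → ℕ} {s : CoxPiece hp n}
    (hs : (coxTrivialization hp).Represents s (expMonomial m)) :
    ofTwisted hp (DirectSum.of (CoxPiece hp) n s) = normalWord n m := by
  have hm : expMonomial m = basisMonomials (Fin 6) ℂ (Finsupp.equivFunOnFinite.symm m) := by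
    rw [coe_basisMonomials, expMonomial]
  rw [ofTwisted, ← DirectSum.lof_eq_of ℂ, DirectSum.toModule_lof, LinearMap.comp_apply,
    toPoly_eq hs, hm, Module.Basis.constr_basis]
  rfl

theorem leftInverse_ofTwisted : Function.LeftInverse (ofTwisted hp) (toTwisted hp) := by
  have h : ofTwisted hp ∘ₗ (toTwisted hp).toLinearMap = LinearMap.id := by
    refine LinearMap.ext_on span_words ?_
    rintro _ ⟨w, rfl⟩
    obtain ⟨s, hs, hr⟩ := exists_word_section hp w
    rw [LinearMap.comp_apply, AlgHom.toLinearMap_apply, toTwisted_word, hs, ofTwisted_of hp hr,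
      LinearMap.id_apply, prod_gen_eq_normalWord]
  exact LinearMap.congr_fun h

theorem exists_toPoly_eq_monomial {n : ℕ} {s : CoxPiece hp n} {m : Fin 6 →₀ ℕ}
    (hm : (toPoly hp n s).coeff m ≠ 0) : ∃ t : CoxPiece hp n, toPoly hp n t = monomial m 1 ∧
      DirectSum.of (CoxPiece hp) n t ∈ (component n).map (toTwisted hp).toLinearMap := by
  obtain ⟨w, rfl, hw⟩ := exists_word (isTwistExponent_of_represents (represents_toPoly hp s) hm)
  obtain ⟨t, ht, hr⟩ := exists_word_section hp w
  refine ⟨t, (toPoly_eq hr).trans ?_, ?_⟩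
  · rw [hw, expMonomial]
    exact congrArg (monomial · 1) (Finsupp.equivFunOnFinite.symm_apply_apply m)
  · rw [← ht, ← toTwisted_word]
    exact Submodule.mem_map_of_mem (Submodule.subset_span ⟨w, rfl, rfl⟩)

theorem of_mem_map_component {n : ℕ} (s : CoxPiece hp n) :
    DirectSum.of (CoxPiece hp) n s ∈ (component n).map (toTwisted hp).toLinearMap := by
  choose! t ht hmem using fun m => exists_toPoly_eq_monomial hp (s := s) (m := m)
  have hs : s = ∑ m ∈ (toPoly hp n s).support, (toPoly hp n s).coeff m • t m := by
    apply toPoly_injective hp n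
    rw [map_sum]
    conv_lhs => rw [(toPoly hp n s).as_sum]
    refine Finset.sum_congr rfl fun m hm => ?_
    rw [map_smul, ht m (mem_support_iff.1 hm), smul_monomial, smul_eq_mul, mul_one]
  rw [hs, ← DirectSum.lof_eq_of ℂ, map_sum]
  refine Submodule.sum_mem _ fun m hm => ?_
  rw [map_smul]
  exact Submodule.smul_mem _ _ (hmem m (mem_support_iff.1 hm))

theorem map_component (n : ℕ) : (component n).map (toTwisted hp).toLinearMap =
    LinearMap.range (DirectSum.lof ℂ ℕ (CoxPiece hp) n) := by
  refine le_antisymm ?_ ?_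
  · rw [component, Submodule.map_span, Submodule.span_le]
    rintro _ ⟨_, ⟨w, rfl, rfl⟩, rfl⟩
    obtain ⟨s, hs, -⟩ := exists_word_section hp w
    rw [AlgHom.toLinearMap_apply, toTwisted_word, hs]
    exact ⟨s, rfl⟩
  · rintro _ ⟨s, rfl⟩
    exact of_mem_map_component hp s

theorem toTwisted_bijective : Function.Bijective (toTwisted hp) := by
  refine ⟨(leftInverse_ofTwisted hp).injective, fun z => ?_⟩
  induction z using DirectSum.induction_on with
  | zero => exact ⟨0, map_zero _⟩
  | of n s =>
    obtain ⟨r, -, hr⟩ := of_mem_map_component hp s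
    exact ⟨r, hr⟩
  | add a b ha hb =>
    obtain ⟨r, rfl⟩ := ha
    obtain ⟨r', rfl⟩ := hb
    exact ⟨r + r', map_add _ _ _⟩

end Isomorphism

end DelPezzo

end

theorem theorem1p2 (p : Fin 3 → Plane) (hp : Projectivization.Independent p) :
    ∃ (σ : VAut (BlowUp p)) (L : LineBundle (BlowUp p)),
      orderOf σ = 6 ∧
      (∀ c, (σ : Equiv.Perm (BlowUp p)) (coxMap hp c) = coxMap hp (coxShift c)) ∧
      (∀ k, (σ : Equiv.Perm (BlowUp p)) ⁻¹' hexagon p k = hexagon p (k + 1)) ∧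
      L.IsOfDivisor (lineCurve p 0) ∧
      ∃ (T : CoxTrivialization hp L) (x : TwistedPiece L σ 1) (y : TwistedPiece L σ 2)
        (Φ : AlgR ≃ₐ[ℂ] TwistedRing L σ),
        T.Represents x (MvPolynomial.X 0) ∧
        T.Represents y (MvPolynomial.X 2 * MvPolynomial.X 4) ∧
        Φ (gen 0) = DirectSum.of (TwistedPiece L σ) 1 x ∧
        Φ (gen 1) = DirectSum.of (TwistedPiece L σ) 2 y ∧
        ∀ n, (component n).map Φ.toLinearMap =
          LinearMap.range (DirectSum.lof ℂ ℕ (TwistedPiece L σ) n) :=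
  ⟨shiftAut hp, coxBundle hp, orderOf_shiftAut hp, shiftAut_coxMap hp,
    shiftAut_preimage_hexagon hp, isOfDivisor_coxBundle hp,
    coxTrivialization hp, sectionX hp, sectionY hp,
    AlgEquiv.ofBijective (toTwisted hp) (toTwisted_bijective hp),
    represents_sectionX hp, represents_sectionY hp,
    toTwisted_gen hp 0, toTwisted_gen hp 1, map_component hp⟩
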